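/- **Setting.** A timed word over $\Sigma$ is an infinite sequence $(\sigma_i,\tau_i)_{i\ge1}$ with $\sigma_i\in\Sigma$ and $(\tau_i)$ a non-decreasing unbounded sequence in $\mathbb R_{\ge0}$. $\mathrm{EMITL}_{0,\infty}$ formulae over a finite set $\mathrm{AP}$ are built from $\top$, propositions, $\wedge$, $\neg$ and automata modalities $\mathcal A_I(\phi_1,\dots,\phi_n)$, where $\mathcal A$ is an NFA (with one initial location) over the alphabet $\{1,\dots,n\}$ and $I$ is a lower or upper bound with constant in $\mathbb N$. They are read pointwise over timed words over $2^{\mathrm{AP}}$: $(\rho,i)\models\mathcal A_I(\phi_1,\dots,\phi_n)$ iff there are $j\ge i$ with $\tau_j-\tau_i\in I$ and a word $a_i\cdots a_j$ accepted by $\mathcal A$ with $(\rho,\ell)\models\phi_{a_\ell}$ for all $i\le\ell\le j$. The dual modality is $\tilde{\mathcal A}_I(\phi_1,\dots,\phi_n)=\neg\mathcal A_I(\neg\phi_1,\dots,\neg\phi_n)$; $\mathbf G\phi=\neg(\top\,\mathbf U\,\neg\phi)$ says that $\phi$ holds at the current and all later positions. $[\![\phi]\!]$ is the set of timed words satisfying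 $\phi$ at position $1$. Timed automata have generalised Büchi acceptance and clock guards that are conjunctions of comparisons with natural numbers; clocks start at $0$ at time $0$; $[\![\mathcal C]\!]$ is the language accepted by $\mathcal C$. Let $\phi$ be an $\mathrm{EMITL}_{0,\infty}$ formula over $\mathrm{AP}$ in negative normal form and $\Phi$ the set of its temporal subformulae (those with outermost operator $\mathcal A_I$ or $\tilde{\mathcal A}_I$). Let $\mathrm{AP}_\Phi=\{p_\psi\mid\psi\in\Phi\}$ be fresh propositions and $\Sigma=2^{\mathrm{AP}\cup\mathrm{AP}_\Phi}$. For a subformula $\chi$ of $\phi$, let $\overline\chi$ be the Boolean formula obtained from $\chi$ by replacing each top-level temporal subformula $\psi'$ by $p_{\psi'}$. Let $\psi=\mathcal A_{\ge c}(\phi_1,\dots,\phi_n)\in\Phi$ with $c\in\mathbb N$, and let $\mathcal A$ have set of locations $S^{\mathcal A}$, $|S^{\mathcal A}|=m$, initial location $s_0$ and final locations $F^{\mathcal A}$. Assume that $c>0$ or that every nonempty word accepted by $\mathcal A$ has length at least $2$. **The automaton $\mathcal C^\psi$.** For $\sigma\in\Sigma$ and $S\subseteq S^{\mathcal A}$ write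 $S\xrightarrow[\vee]{\sigma}S'$ iff $S'$ is an inclusion-minimal set such that each $s\in S$ has a transition $s\xrightarrow{a}s'$ of $\mathcal A$ with $\sigma\models\overline{\phi_a}$ and $s'\in S'$. Say that $S$ is *discharged* by $\sigma$ iff $S=\{s\}$ and there is a transition $s\xrightarrow{a}s'$ with $\sigma\models\overline{\phi_a}$ and $s'\in F^{\mathcal A}$. The locations of $\mathcal C^\psi$ are $m$-tuples of $\langle\ell_j,S_j,T_j\rangle$ with $\ell_j\in\{0,1,2,3\}$ and $S_j,T_j\subseteq S^{\mathcal A}$; initially all are $\langle0,\emptyset,\emptyset\rangle$. The clocks are $x_1,\dots,x_m$. The final sets are $F_1,\dots,F_m$, where $F_j$ consists of the locations with $\ell_j\in\{0,2\}$. Sub-component $j$, with clock $x=x_j$, has the following transitions on $\sigma$ (with guard $\top$ and no reset unless stated). Non-trigger transitions: 1. $\langle0,\emptyset,\emptyset\rangle\to\langle0,\emptyset,\emptyset\rangle$. 2. $\langle\ell,S,\emptyset\rangle\to\langle1,S',\emptyset\rangle$ for $\ell\in\{1,2\}$ and $S\xrightarrow[\vee]{\sigma}S'$. 3. $\langle3,S,T\rangle\to\langle3,S',T'\rangle$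 for $S\xrightarrow[\vee]{\sigma}S'$ and $T\xrightarrow[\vee]{\sigma}T'$. 4. $\langle\ell,S,\emptyset\rangle\to\langle0,\emptyset,\emptyset\rangle$ for $\ell\in\{1,2\}$ and $S$ discharged by $\sigma$; guard $x\ge c$. 5. $\langle3,S,T\rangle\to\langle2,S',\emptyset\rangle$ for $S$ discharged by $\sigma$ and $T\xrightarrow[\vee]{\sigma}S'$; guard $x\ge c$; reset $x$. Trigger transitions, each for some $S_0$ with $\{s_0\}\xrightarrow[\vee]{\sigma}S_0$: 6. $\langle0,\emptyset,\emptyset\rangle\to\langle1,S_0,\emptyset\rangle$; reset $x$. 7. $\langle\ell,S,\emptyset\rangle\to\langle1,S'\cup S_0,\emptyset\rangle$ for $\ell\in\{1,2\}$ and $S\xrightarrow[\vee]{\sigma}S'$; reset $x$. 8. $\langle1,S,\emptyset\rangle\to\langle3,S',S_0\rangle$ for $S\xrightarrow[\vee]{\sigma}S'$. 9. $\langle3,S,T\rangle\to\langle3,S',T'\cup S_0\rangle$ for $S\xrightarrow[\vee]{\sigma}S'$ and $T\xrightarrow[\vee]{\sigma}T'$. 10. $\langle\ell,S,\emptyset\rangle\to\langle2,S_0,\emptyset\rangle$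 for $\ell\in\{1,2\}$ and $S$ discharged by $\sigma$; guard $x\ge c$; reset $x$. 11. $\langle3,S,T\rangle\to\langle2,T'\cup S_0,\emptyset\rangle$ for $S$ discharged by $\sigma$ and $T\xrightarrow[\vee]{\sigma}T'$; guard $x\ge c$; reset $x$. A transition of $\mathcal C^\psi$ on $\sigma$ combines one transition of each sub-component, with the conjunction of the guards and the union of the resets. If $p_\psi\in\sigma$, exactly one sub-component takes a trigger transition and the others take non-trigger ones; if $p_\psi\notin\sigma$, all take non-trigger transitions. **Proposition.** $[\![\mathcal C^\psi]\!]=[\![\mathbf G\big(p_\psi\Rightarrow\mathcal A_{\ge c}(\overline{\phi_1},\dots,\overline{\phi_n})\big)]\!]$. -/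

import Mathlib

universe u

/-! ## Timed words -/

/-- Timed words over `Γ`. Events are numbered from `0`, so that index `i` is the event usually
numbered `i + 1`. -/
structure TimedWord (Γ : Type u) where
  letter : ℕ → Γ
  time : ℕ → ℝ
  nonneg : ∀ i, 0 ≤ time i
  mono : Monotone time
  nonZeno : ∀ r : ℝ, ∃ j, r ≤ time j

/-- The time that elapses immediately before event `i`; the clock starts at time `0`. -/
def TimedWord.delay {Γ : Type u} (ρ : TimedWord Γ) : ℕ → ℝ
  | 0 => ρ.time 0
  | i + 1 => ρ.time (i + 1) - ρ.time i

/-! ## Timed automata -/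

inductive Comparison : Type
  | le | lt | ge | gt

def Comparison.Holds : Comparison → ℝ → ℝ → Prop
  | le, a, b => a ≤ b
  | lt, a, b => a < b
  | ge, a, b => a ≥ b
  | gt, a, b => a > b

inductive ClockConstraint (X : Type) : Type
  | top : ClockConstraint X
  | and : ClockConstraint X → ClockConstraint X → ClockConstraint X
  | cmp : X → Comparison → ℕ → ClockConstraint X

namespace ClockConstraint

def Sat {X : Type} (v : X → ℝ) : ClockConstraint X → Prop
  | top => True
  | and g h => g.Sat v ∧ h.Sat v
  | cmp x r c => r.Holds (v x) c

/-- The conjunction `g 0 ∧ (g 1 ∧ (⋯ ∧ ⊤))`. -/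
def conj {X : Type} {m : ℕ} (g : Fin m → ClockConstraint X) : ClockConstraint X :=
  (List.ofFn g).foldr and top

end ClockConstraint

/-- Timed automata with generalised Büchi acceptance. -/
structure TimedAutomaton (Γ : Type u) where
  Loc : Type
  Clock : Type
  finiteLoc : Finite Loc
  finiteClock : Finite Clock
  init : Loc
  trans : Set (Loc × Γ × ClockConstraint Clock × Set Clock × Loc)
  final : Set (Set Loc)

namespace TimedAutomaton

variable {Γ : Type u}

open Classical in
/-- The state sequence `(s 0, v 0), (s 1, v 1), …` is a run on `ρ`. (All the valuations of a run
are automatically nonnegative.) -/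
def IsRun (C : TimedAutomaton Γ) (ρ : TimedWord Γ) (s : ℕ → C.Loc) (v : ℕ → C.Clock → ℝ) : Prop :=
  s 0 = C.init ∧ (∀ x, v 0 x = 0) ∧
    ∀ i, ∃ (g : ClockConstraint C.Clock) (r : Set C.Clock),
      (s i, ρ.letter i, g, r, s (i + 1)) ∈ C.trans ∧
      g.Sat (fun x => v i x + ρ.delay i) ∧
      ∀ x, v (i + 1) x = if x ∈ r then 0 else v i x + ρ.delay i

/-- Each final set contains a location that is visited infinitely often. -/
def IsAccepting (C : TimedAutomaton Γ) (s : ℕ → C.Loc) : Prop :=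
  ∀ F ∈ C.final, ∃ q ∈ F, ∀ N, ∃ i ≥ N, s i = q

def language (C : TimedAutomaton Γ) : Set (TimedWord Γ) :=
  {ρ | ∃ s v, C.IsRun ρ s v ∧ C.IsAccepting s}

end TimedAutomaton

/-! ## The logic -/

/-- Nondeterministic finite automata over the `n`-ary alphabet, with a single initial location. -/
structure ModalityNFA (n : ℕ) where
  Loc : Type
  finiteLoc : Finite Loc
  init : Loc
  trans : Loc → Fin n → Loc → Prop
  final : Set Loc

/-- There is an accepting run on the word `w` of length `k`. -/
def ModalityNFA.Accepts {n k : ℕ} (A : ModalityNFA n) (w : Fin k → Fin n) : Prop :=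
  ∃ r : Fin (k + 1) → A.Loc, r 0 = A.init ∧
    (∀ t : Fin k, A.trans (r t.castSucc) (w t) (r t.succ)) ∧ r (Fin.last k) ∈ A.final

/-- Lower and upper bounds with constants in `ℕ`; `ge 0` is the trivial constraint `[0, ∞)`. -/
inductive TimeBound : Type
  | le : ℕ → TimeBound
  | lt : ℕ → TimeBound
  | ge : ℕ → TimeBound
  | gt : ℕ → TimeBound

def TimeBound.toSet : TimeBound → Set ℝ
  | le c => Set.Icc 0 (c : ℝ)
  | lt c => Set.Ico 0 (c : ℝ)
  | ge c => Set.Ici (c : ℝ)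
  | gt c => Set.Ioi (c : ℝ)

/-- Formulae of `EMITL` over the propositions `P` all of whose constraining intervals are lower
or upper bounds, i.e. formulae of `EMITL_{0,∞}`. -/
inductive EMITL (P : Type u) : Type (max u 1)
  | top : EMITL P
  | atom : P → EMITL P
  | and : EMITL P → EMITL P → EMITL P
  | neg : EMITL P → EMITL P
  | aut : {n : ℕ} → ModalityNFA n → TimeBound → (Fin n → EMITL P) → EMITL P

namespace EMITL

variable {P : Type u}

/-- Pointwise semantics. In the clause for `aut` the witnessing position is `i + k`, and the word
`w` of length `k + 1` labels the positions `i, …, i + k`. -/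
def Sat (ρ : TimedWord (Set P)) : EMITL P → ℕ → Prop
  | top, _ => True
  | atom p, i => p ∈ ρ.letter i
  | and φ χ, i => φ.Sat ρ i ∧ χ.Sat ρ i
  | neg φ, i => ¬ φ.Sat ρ i
  | @aut _ n A I args, i => ∃ k : ℕ, ρ.time (i + k) - ρ.time i ∈ I.toSet ∧
      ∃ w : Fin (k + 1) → Fin n, A.Accepts w ∧ ∀ t, (args (w t)).Sat ρ (i + t)

/-- The timed words that satisfy `φ` at their first position. -/
def language (φ : EMITL P) : Set (TimedWord (Set P)) := {ρ | φ.Sat ρ 0}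

def bot : EMITL P := neg top

def or (φ χ : EMITL P) : EMITL P := neg (and (neg φ) (neg χ))

def imp (φ χ : EMITL P) : EMITL P := or (neg φ) χ

/-- The automaton of the `until` modality: it accepts the words `1 ⋯ 1 2` (with letters `0` and
`1` of `Fin 2` standing for `1` and `2`). -/
def untilNFA : ModalityNFA 2 where
  Loc := Bool
  finiteLoc := inferInstance
  init := false
  trans s a t := s = false ∧ ((a = 0 ∧ t = false) ∨ (a = 1 ∧ t = true))
  final := {true}

def untl (I : TimeBound) (φ χ : EMITL P) : EMITL P := aut untilNFA I ![φ, χ]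

def eventually (φ : EMITL P) : EMITL P := untl (.ge 0) top φ

def globally (φ : EMITL P) : EMITL P := neg (eventually (neg φ))

end EMITL

/-! ## Negative normal form and triggers -/

/-- `EMITL_{0,∞}` formulae in negative normal form; `dualAut A I args` is `¬ A_I(¬ args)`. -/
inductive EMITLNNF (AP : Type u) : Type (max u 1)
  | top : EMITLNNF AP
  | bot : EMITLNNF AP
  | atom : AP → EMITLNNF AP
  | negAtom : AP → EMITLNNF AP
  | and : EMITLNNF AP → EMITLNNF AP → EMITLNNF AP
  | or : EMITLNNF AP → EMITLNNF AP → EMITLNNF AP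
  | aut : {n : ℕ} → ModalityNFA n → TimeBound → (Fin n → EMITLNNF AP) → EMITLNNF AP
  | dualAut : {n : ℕ} → ModalityNFA n → TimeBound → (Fin n → EMITLNNF AP) → EMITLNNF AP

/-- Boolean combinations of atomic propositions in negative normal form. -/
inductive BoolNNF (P : Type u) : Type u
  | top : BoolNNF P
  | bot : BoolNNF P
  | atom : P → BoolNNF P
  | negAtom : P → BoolNNF P
  | and : BoolNNF P → BoolNNF P → BoolNNF P
  | or : BoolNNF P → BoolNNF P → BoolNNF P

namespace BoolNNF

variable {P : Type u}

/-- Satisfaction by a letter `σ ∈ 2^P`. -/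
def Holds (σ : Set P) : BoolNNF P → Prop
  | top => True
  | bot => False
  | atom p => p ∈ σ
  | negAtom p => p ∉ σ
  | and β γ => β.Holds σ ∧ γ.Holds σ
  | or β γ => β.Holds σ ∨ γ.Holds σ

def toEMITL : BoolNNF P → EMITL P
  | top => .top
  | bot => .bot
  | atom p => .atom p
  | negAtom p => .neg (.atom p)
  | and β γ => .and β.toEMITL γ.toEMITL
  | or β γ => .or β.toEMITL γ.toEMITL

end BoolNNF

namespace EMITLNNF

variable {AP : Type u}

/-- The set `Φ` of all temporal subformulae. -/
def temporalSubs : EMITLNNF AP → Set (EMITLNNF AP)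
  | and φ χ => φ.temporalSubs ∪ χ.temporalSubs
  | or φ χ => φ.temporalSubs ∪ χ.temporalSubs
  | aut A I args => insert (aut A I args) (⋃ a, (args a).temporalSubs)
  | dualAut A I args => insert (dualAut A I args) (⋃ a, (args a).temporalSubs)
  | _ => ∅

/-- The propositions `AP ∪ AP_Φ`: those in `AP` and one trigger for each `ψ ∈ Φ`. -/
abbrev ExtProp (φ : EMITLNNF AP) : Type (max u 1) := AP ⊕ φ.temporalSubs

/-- `overline φ χ h` is the formula obtained from `χ` by replacing the top-level temporal
subformulae of `χ` by their triggers; `h` says that the subformulae are among those of `φ`. -/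
def overline (φ : EMITLNNF AP) :
    (χ : EMITLNNF AP) → χ.temporalSubs ⊆ φ.temporalSubs → BoolNNF φ.ExtProp
  | top, _ => .top
  | bot, _ => .bot
  | atom p, _ => .atom (.inl p)
  | negAtom p, _ => .negAtom (.inl p)
  | and χ₁ χ₂, h =>
      .and (overline φ χ₁ (Set.subset_union_left.trans h))
        (overline φ χ₂ (Set.subset_union_right.trans h))
  | or χ₁ χ₂, h =>
      .or (overline φ χ₁ (Set.subset_union_left.trans h))
        (overline φ χ₂ (Set.subset_union_right.trans h))
  | aut A I args, h => .atom (.inr ⟨aut A I args, h (Set.mem_insert _ _)⟩)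
  | dualAut A I args, h => .atom (.inr ⟨dualAut A I args, h (Set.mem_insert _ _)⟩)

theorem temporalSubs_subset {φ ψ : EMITLNNF AP} (h : ψ ∈ φ.temporalSubs) :
    ψ.temporalSubs ⊆ φ.temporalSubs := by
  induction φ with
  | top => exact absurd h (Set.notMem_empty _)
  | bot => exact absurd h (Set.notMem_empty _)
  | atom p => exact absurd h (Set.notMem_empty _)
  | negAtom p => exact absurd h (Set.notMem_empty _)
  | and φ χ ih₁ ih₂ =>
    rcases h with h | h
    · exact (ih₁ h).trans Set.subset_union_left
    · exact (ih₂ h).trans Set.subset_union_right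
  | or φ χ ih₁ ih₂ =>
    rcases h with h | h
    · exact (ih₁ h).trans Set.subset_union_left
    · exact (ih₂ h).trans Set.subset_union_right
  | aut A I args ih =>
    rcases h with h | h
    · subst h; exact subset_rfl
    · obtain ⟨a, ha⟩ := Set.mem_iUnion.1 h
      exact (ih a ha).trans ((Set.subset_iUnion (fun a => (args a).temporalSubs) a).trans
        (Set.subset_insert _ _))
  | dualAut A I args ih =>
    rcases h with h | h
    · subst h; exact subset_rfl
    · obtain ⟨a, ha⟩ := Set.mem_iUnion.1 h
      exact (ih a ha).trans ((Set.subset_iUnion (fun a => (args a).temporalSubs) a).trans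
        (Set.subset_insert _ _))

theorem arg_temporalSubs_subset {φ : EMITLNNF AP} {n : ℕ} {A : ModalityNFA n} {I : TimeBound}
    {args : Fin n → EMITLNNF AP} (h : aut A I args ∈ φ.temporalSubs) (a : Fin n) :
    (args a).temporalSubs ⊆ φ.temporalSubs :=
  ((Set.subset_iUnion (fun a => (args a).temporalSubs) a).trans (Set.subset_insert _ _)).trans
    (temporalSubs_subset h)

end EMITLNNF

/-! ## The component automaton for a lower-bound modality -/

namespace ModalityNFA

variable {n : ℕ} (A : ModalityNFA n)

/-- `A.VeeStep en S S'` is `S →_∨ S'` for a letter that enables exactly the arguments in `en`: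
the set `S'` is inclusion-minimal such that each location of `S` has an enabled transition
into it. -/
def VeeStep (en : Set (Fin n)) (S S' : Set A.Loc) : Prop :=
  Minimal (fun T : Set A.Loc => ∀ s ∈ S, ∃ a ∈ en, ∃ t ∈ T, A.trans s a t) S'

/-- The set `S` is a singleton `{s}`, and `s` has an enabled transition to a final location. -/
def Discharges (en : Set (Fin n)) (S : Set A.Loc) : Prop :=
  ∃ s, S = {s} ∧ ∃ a ∈ en, ∃ t ∈ A.final, A.trans s a t

/-- Locations `⟨ℓ, S, T⟩` of a sub-component. -/
abbrev SubLoc : Type := Fin 4 × Set A.Loc × Set A.Loc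

/-- The transitions `⟨ℓ, S, T⟩ → ⟨ℓ', S', T'⟩` of a sub-component with clock `x`, for the lower
bound `c`. The Boolean is `true` for the transitions that take charge of the current trigger and
`false` for the others; then come the source, the guard, the reset set and the target. -/
inductive SubStep {X : Type} (en : Set (Fin n)) (c : ℕ) (x : X) :
    Bool → A.SubLoc → ClockConstraint X → Set X → A.SubLoc → Prop
  | idle : SubStep en c x false (0, ∅, ∅) .top ∅ (0, ∅, ∅)
  | wait (l : Fin 4) (S S' : Set A.Loc) (hl : l = 1 ∨ l = 2) (hS : A.VeeStep en S S') :
      SubStep en c x false (l, S, ∅) .top ∅ (1, S', ∅)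
  | waitBuffered (S S' T T' : Set A.Loc) (hS : A.VeeStep en S S') (hT : A.VeeStep en T T') :
      SubStep en c x false (3, S, T) .top ∅ (3, S', T')
  | finish (l : Fin 4) (S : Set A.Loc) (hl : l = 1 ∨ l = 2) (hS : A.Discharges en S) :
      SubStep en c x false (l, S, ∅) (.cmp x .ge c) ∅ (0, ∅, ∅)
  | finishBuffered (S T S' : Set A.Loc) (hT : A.VeeStep en T S') (hS : A.Discharges en S) :
      SubStep en c x false (3, S, T) (.cmp x .ge c) {x} (2, S', ∅)
  | pullStart (S' : Set A.Loc) (h0 : A.VeeStep en {A.init} S') :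
      SubStep en c x true (0, ∅, ∅) .top {x} (1, S', ∅)
  | pullMerge (l : Fin 4) (S S₁ S₂ : Set A.Loc) (hl : l = 1 ∨ l = 2) (hS : A.VeeStep en S S₁)
      (h0 : A.VeeStep en {A.init} S₂) :
      SubStep en c x true (l, S, ∅) .top {x} (1, S₁ ∪ S₂, ∅)
  | pullOpenBuffer (S S' T' : Set A.Loc) (hS : A.VeeStep en S S')
      (h0 : A.VeeStep en {A.init} T') :
      SubStep en c x true (1, S, ∅) .top ∅ (3, S', T')
  | pullBuffer (S S' T T₁ T₂ : Set A.Loc) (hS : A.VeeStep en S S') (hT : A.VeeStep en T T₁)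
      (h0 : A.VeeStep en {A.init} T₂) :
      SubStep en c x true (3, S, T) .top ∅ (3, S', T₁ ∪ T₂)
  | pullFinish (l : Fin 4) (S S' : Set A.Loc) (hl : l = 1 ∨ l = 2)
      (h0 : A.VeeStep en {A.init} S') (hS : A.Discharges en S) :
      SubStep en c x true (l, S, ∅) (.cmp x .ge c) {x} (2, S', ∅)
  | pullFinishBuffered (S T S₁ S₂ : Set A.Loc) (hT : A.VeeStep en T S₁)
      (h0 : A.VeeStep en {A.init} S₂) (hS : A.Discharges en S) :
      SubStep en c x true (3, S, T) (.cmp x .ge c) {x} (2, S₁ ∪ S₂, ∅)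

end ModalityNFA

/-- The component automaton `C^ψ` over `Σ = 2^P` for `ψ = A_{≥ c}(β 0, …, β (n-1))` with trigger
`p`. It has `m` sub-components and `m` clocks, where `m` is the number of locations of `A`. At a
letter that contains `p` exactly one sub-component takes a trigger transition, at the other letters
none does; guards are conjoined and resets united. -/
noncomputable def geComponent {P : Type u} {n : ℕ} (A : ModalityNFA n) (c : ℕ) (p : P)
    (β : Fin n → BoolNNF P) : TimedAutomaton (Set P) where
  Loc := Fin (Nat.card A.Loc) → A.SubLoc
  Clock := Fin (Nat.card A.Loc)
  finiteLoc := by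
    have := A.finiteLoc
    infer_instance
  finiteClock := inferInstance
  init := fun _ => (0, ∅, ∅)
  trans := {(s, σ, g, r, s') |
    ∃ (pull : Fin (Nat.card A.Loc) → Bool)
      (g' : Fin (Nat.card A.Loc) → ClockConstraint (Fin (Nat.card A.Loc)))
      (r' : Fin (Nat.card A.Loc) → Set (Fin (Nat.card A.Loc))),
      (p ∈ σ → ∃! j, pull j = true) ∧ (p ∉ σ → ∀ j, pull j = false) ∧
      (∀ j, A.SubStep {a | (β a).Holds σ} c j (pull j) (s j) (g' j) (r' j) (s' j)) ∧
      g = ClockConstraint.conj g' ∧ r = ⋃ j, r' j}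
  final := Set.range fun j => {s | (s j).1 = 0 ∨ (s j).1 = 2}

/-! Soundness follows single obligations. Each vee-step offers every location of `S` or `T` a
successor in the next set, so a run of `A` can be traced from a trigger. The Büchi condition brings
each sub-component back to `ℓ = 0` or `ℓ = 2`; with `S` nonempty this happens only by discharging
`S`. The clock was last reset no earlier than any trigger behind `S`, so the guard yields the time
bound (`exists_canAccept_init`).

Completeness must manage with one sub-component per location of `A`. The rank of a location is the
supremum of its acceptance positions, plus one. A guide `f` picks successors of unchanged rank
(`exists_isGuide`), and `Meets` groups the live locations into classes whose guided runs coalesce.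
Each class is served by at most one busy sub-component. Distinct classes that outlive the current
position have distinct guided successors, so a trigger of a new class always finds a free
sub-component (`GoodConfig.exists_idle`).

In a class of finite rank `e + 1` all guided runs have coalesced by position `e`, the last and hence
best place to accept; new triggers share `e`, so merging them and resetting the clock does no harm.
In a class of infinite rank the coalesced run can accept arbitrarily late
(`IsGuide.exists_canDischarge`), so a discharge late enough for the clock is planned. Triggers
arriving meanwhile wait in the buffer `T`, which takes the place of `S` once the plan is carried
out. Deadlines that stay fixed until the next visit to `ℓ = 0` or `ℓ = 2` give acceptance
(`Track.Keeps.frequently`).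

The assumption on `c` or on word lengths puts every acceptance strictly after its trigger, as a
trigger transition only starts an obligation. -/

namespace ModalityNFA

variable {n : ℕ} (A : ModalityNFA n)

/-! ### Acceptance positions, ranks and guided runs -/

/-- From location `s` before position `t`, some run reads letters enabled at the positions
`t, …, e` and ends in a final location. -/
inductive CanAccept (en : ℕ → Set (Fin n)) : ℕ → A.Loc → ℕ → Prop
  | last {t : ℕ} {s s' : A.Loc} {a : Fin n} (ha : a ∈ en t) (h : A.trans s a s')
      (hs' : s' ∈ A.final) : CanAccept en t s t
  | step {t e : ℕ} {s s' : A.Loc} {a : Fin n} (ha : a ∈ en t) (h : A.trans s a s')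
      (hs' : CanAccept en (t + 1) s' e) : CanAccept en t s e

variable {A} {en : ℕ → Set (Fin n)}

theorem CanAccept.le {t e : ℕ} {s : A.Loc} (h : A.CanAccept en t s e) : t ≤ e := by
  induction h with
  | last => exact le_rfl
  | step _ _ _ ih => omega

theorem CanAccept.exists_run {t e : ℕ} {s : A.Loc} (h : A.CanAccept en t s e) :
    ∃ k, e = t + k ∧ ∃ (w : Fin (k + 1) → Fin n) (r : Fin (k + 2) → A.Loc), r 0 = s ∧
      (∀ i : Fin (k + 1), A.trans (r i.castSucc) (w i) (r i.succ)) ∧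
      r (Fin.last (k + 1)) ∈ A.final ∧ ∀ i : Fin (k + 1), w i ∈ en (t + i) := by
  induction h with
  | @last t s s' a ha h hs' =>
    refine ⟨0, rfl, fun _ => a, ![s, s'], rfl, fun i => ?_, hs', fun i => ?_⟩
    · fin_cases i; exact h
    · fin_cases i; exact ha
  | @step t e s s' a ha h _ ih =>
    obtain ⟨k, rfl, w, r, h0, htr, hfin, hw⟩ := ih
    refine ⟨k + 1, by ring, Fin.cons a w, Fin.cons s r, rfl, fun i => ?_, ?_, fun i => ?_⟩
    · induction i using Fin.cases with
      | zero => simpa [h0] using h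
      | succ i => simpa [← Fin.succ_castSucc] using htr i
    · rw [← Fin.succ_last]; simpa using hfin
    · induction i using Fin.cases with
      | zero => simpa using ha
      | succ i =>
        have := hw i
        simp only [Fin.cons_succ, Fin.val_succ]
        convert this using 2
        ring

theorem canAccept_of_run {k : ℕ} : ∀ {t : ℕ} {s : A.Loc} (w : Fin (k + 1) → Fin n)
    (r : Fin (k + 2) → A.Loc), r 0 = s →
    (∀ i : Fin (k + 1), A.trans (r i.castSucc) (w i) (r i.succ)) →
    r (Fin.last (k + 1)) ∈ A.final → (∀ i : Fin (k + 1), w i ∈ en (t + i)) →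
    A.CanAccept en t s (t + k) := by
  induction k with
  | zero =>
    rintro t s w r rfl htr hfin hw
    exact .last (by simpa using hw 0) (htr 0) hfin
  | succ k ih =>
    rintro t s w r rfl htr hfin hw
    refine .step (by simpa using hw 0) (htr 0) ?_
    have := ih (t := t + 1) (fun i => w i.succ) (fun i => r i.succ) rfl
      (fun i => by simpa [← Fin.succ_castSucc] using htr i.succ)
      (by simpa [Fin.succ_last] using hfin)
      (fun i => by
        have := hw i.succ
        simp only [Fin.val_succ] at this
        convert this using 2
        ring)
    convert this using 1
    ring

theorem canAccept_init_iff {t k : ℕ} :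
    A.CanAccept en t A.init (t + k) ↔
      ∃ w : Fin (k + 1) → Fin n, A.Accepts w ∧ ∀ i : Fin (k + 1), w i ∈ en (t + i) := by
  constructor
  · intro h
    obtain ⟨k', hk, w, r, h0, htr, hfin, hw⟩ := h.exists_run
    obtain rfl : k = k' := by omega
    exact ⟨w, ⟨r, h0, htr, hfin⟩, hw⟩
  · rintro ⟨w, ⟨r, h0, htr, hfin⟩, hw⟩
    exact canAccept_of_run w r h0 htr hfin hw

variable (A) in
/-- The supremum of the `e + 1` such that a run from `s` before position `t` can accept at `e`. -/
noncomputable def rank (en : ℕ → Set (Fin n)) (t : ℕ) (s : A.Loc) : ℕ∞ :=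
  ⨆ (e : ℕ) (_ : A.CanAccept en t s e), ((e + 1 : ℕ) : ℕ∞)

theorem CanAccept.lt_rank {t e : ℕ} {s : A.Loc} (h : A.CanAccept en t s e) :
    (e : ℕ∞) < A.rank en t s :=
  lt_of_lt_of_le (by exact_mod_cast Nat.lt_succ_self e)
    (le_iSup₂ (f := fun (e : ℕ) (_ : A.CanAccept en t s e) => ((e + 1 : ℕ) : ℕ∞)) e h)

theorem exists_canAccept_of_lt_rank {t M : ℕ} {s : A.Loc} (h : (M : ℕ∞) < A.rank en t s) :
    ∃ e, M ≤ e ∧ A.CanAccept en t s e := by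
  simp only [rank, lt_iSup_iff] at h
  obtain ⟨e, he, h⟩ := h
  exact ⟨e, by have : M < e + 1 := by exact_mod_cast h
               omega, he⟩

theorem rank_le_iff {t : ℕ} {s : A.Loc} {x : ℕ∞} :
    A.rank en t s ≤ x ↔ ∀ e, A.CanAccept en t s e → (e : ℕ∞) + 1 ≤ x := by
  simp [rank, iSup_le_iff]

theorem canAccept_of_rank_eq {t e : ℕ} {s : A.Loc} (h : A.rank en t s = (e + 1 : ℕ)) :
    A.CanAccept en t s e := by
  obtain ⟨e', he, h'⟩ := exists_canAccept_of_lt_rank (A := A) (en := en) (t := t) (s := s) (M := e)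
    (by rw [h]; exact_mod_cast Nat.lt_succ_self e)
  have := h'.lt_rank
  rw [h] at this
  have : e' < e + 1 := by exact_mod_cast this
  obtain rfl : e = e' := by omega
  exact h'

/-- Among the finitely many enabled successors, one of maximal rank works. Only an acceptance at `t`
itself passes through no such successor, and the assumption provides a later one that does. -/
theorem exists_step_rank_eq {t : ℕ} {s : A.Loc} (h : ((t + 1 : ℕ) : ℕ∞) < A.rank en t s) :
    ∃ s', (∃ a ∈ en t, A.trans s a s') ∧ A.rank en (t + 1) s' = A.rank en t s := by
  have := A.finiteLoc
  obtain ⟨e, he, hacc⟩ := exists_canAccept_of_lt_rank h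
  obtain ⟨s₀, hs₀, hacc₀⟩ : ∃ s', (∃ a ∈ en t, A.trans s a s') ∧ A.CanAccept en (t + 1) s' e := by
    cases hacc with
    | last => omega
    | step ha h hs' => exact ⟨_, ⟨_, ha, h⟩, hs'⟩
  obtain ⟨s', hs', hmax⟩ := Set.exists_max_image {s' | ∃ a ∈ en t, A.trans s a s'}
    (A.rank en (t + 1)) (Set.toFinite _) ⟨s₀, hs₀⟩
  refine ⟨s', hs', le_antisymm (rank_le_iff.2 fun e' h' => ?_) (rank_le_iff.2 fun e' h' => ?_)⟩
  · obtain ⟨a, ha, htr⟩ := hs'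
    exact Order.add_one_le_of_lt (CanAccept.step ha htr h').lt_rank
  · refine Order.add_one_le_of_lt ?_
    cases h' with
    | last =>
      exact lt_of_lt_of_le (lt_of_le_of_lt (by exact_mod_cast (by omega : t ≤ e)) hacc₀.lt_rank)
        (hmax _ hs₀)
    | step ha h hs'' => exact lt_of_lt_of_le hs''.lt_rank (hmax _ ⟨_, ha, h⟩)

variable (A) in
/-- A successor function that loses none of the possible acceptance positions. -/
def IsGuide (en : ℕ → Set (Fin n)) (f : ℕ → A.Loc → A.Loc) : Prop :=
  ∀ t s, ((t + 1 : ℕ) : ℕ∞) < A.rank en t s →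
    (∃ a ∈ en t, A.trans s a (f t s)) ∧ A.rank en (t + 1) (f t s) = A.rank en t s

variable (A en) in
theorem exists_isGuide : ∃ f, A.IsGuide en f := by
  have h : ∀ t s, ∃ s', ((t + 1 : ℕ) : ℕ∞) < A.rank en t s →
      (∃ a ∈ en t, A.trans s a s') ∧ A.rank en (t + 1) s' = A.rank en t s := by
    intro t s
    by_cases h : ((t + 1 : ℕ) : ℕ∞) < A.rank en t s
    · obtain ⟨s', hs'⟩ := exists_step_rank_eq h
      exact ⟨s', fun _ => hs'⟩
    · exact ⟨s, fun h' => absurd h' h⟩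
  choose f hf using h
  exact ⟨f, hf⟩

variable (A) in
/-- The guided runs from `s` and `s'` before position `t` meet while both can still accept. -/
inductive Meets (en : ℕ → Set (Fin n)) (f : ℕ → A.Loc → A.Loc) : ℕ → A.Loc → A.Loc → Prop
  | refl {t : ℕ} {s : A.Loc} (h : (t : ℕ∞) < A.rank en t s) : Meets en f t s s
  | step {t : ℕ} {s s' : A.Loc} (h : ((t + 1 : ℕ) : ℕ∞) < A.rank en t s)
      (h' : ((t + 1 : ℕ) : ℕ∞) < A.rank en t s') (hm : Meets en f (t + 1) (f t s) (f t s')) :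
      Meets en f t s s'

variable {f : ℕ → A.Loc → A.Loc}

namespace Meets

variable {t : ℕ} {s s' s'' : A.Loc}

theorem symm (h : A.Meets en f t s s') : A.Meets en f t s' s := by
  induction h with
  | refl h => exact .refl h
  | step h h' _ ih => exact .step h' h ih

theorem trans (h : A.Meets en f t s s') (h' : A.Meets en f t s' s'') : A.Meets en f t s s'' := by
  induction h generalizing s'' with
  | refl => exact h'
  | step h₁ h₂ hm ih =>
    cases h' with
    | refl => exact .step h₁ h₂ hm
    | step h₃ h₄ hm' => exact .step h₁ h₄ (ih hm')

theorem lt_rank (h : A.Meets en f t s s') : (t : ℕ∞) < A.rank en t s := by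
  cases h with
  | refl h => exact h
  | step h => exact lt_trans (by exact_mod_cast Nat.lt_succ_self t) h

/-- The guide preserves ranks, so equality at the meeting point propagates back. -/
theorem rank_eq (hf : A.IsGuide en f) (h : A.Meets en f t s s') :
    A.rank en t s = A.rank en t s' := by
  induction h with
  | refl => rfl
  | step h h' _ ih => rw [← (hf _ _ h).2, ← (hf _ _ h').2, ih]

theorem next (hf : A.IsGuide en f) (h : A.Meets en f t s s')
    (hs : ((t + 1 : ℕ) : ℕ∞) < A.rank en t s) : A.Meets en f (t + 1) (f t s) (f t s') := by
  cases h with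
  | refl => exact .refl (by rwa [(hf _ _ hs).2])
  | step _ _ h => exact h

/-- Here `t` is the last acceptance position, so no guided step remains in which the runs could
still meet. -/
theorem eq_of_rank_eq (h : A.Meets en f t s s') (hs : A.rank en t s = (t + 1 : ℕ)) : s = s' := by
  cases h with
  | refl => rfl
  | step h => exact absurd hs h.ne'

end Meets

variable (f) in
/-- The guided run from `s` before position `t`, after `k` steps. -/
def orbit : ℕ → ℕ → A.Loc → A.Loc
  | _, 0, s => s
  | t, k + 1, s => orbit (t + 1) k (f t s)

theorem Meets.exists_orbit_eq {t : ℕ} {s s' : A.Loc} (h : A.Meets en f t s s') :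
    ∃ k, ∀ l ≥ k, orbit f t l s = orbit f t l s' := by
  induction h with
  | refl => exact ⟨0, fun _ _ => rfl⟩
  | step _ _ _ ih =>
    obtain ⟨k, hk⟩ := ih
    refine ⟨k + 1, fun l hl => ?_⟩
    obtain ⟨l, rfl⟩ := Nat.exists_eq_add_of_le' (show 1 ≤ l by omega)
    exact hk l (by omega)

/-! ### Vee-steps along the guide and discharging -/

/-- The guided image of a set need not be inclusion-minimal; shrinking it to a minimal set keeps the
target inside the image, which is all the class invariants need. -/
theorem exists_veeStep_subset {E : Set (Fin n)} {S U : Set A.Loc}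
    (h : ∀ s ∈ S, ∃ a ∈ E, ∃ t ∈ U, A.trans s a t) : ∃ S' ⊆ U, A.VeeStep E S S' := by
  have := A.finiteLoc
  obtain ⟨S', hle, hmin⟩ := (Set.toFinite
    {T : Set A.Loc | ∀ s ∈ S, ∃ a ∈ E, ∃ t ∈ T, A.trans s a t}).exists_le_minimal h
  exact ⟨S', hle, hmin⟩

theorem VeeStep.nonempty {E : Set (Fin n)} {S S' : Set A.Loc} (h : A.VeeStep E S S')
    (hS : S.Nonempty) : S'.Nonempty := by
  obtain ⟨s, hs⟩ := hS
  obtain ⟨a, _, t, ht, _⟩ := h.prop s hs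
  exact ⟨t, ht⟩

theorem veeStep_singleton {E : Set (Fin n)} {s s' : A.Loc} (h : ∃ a ∈ E, A.trans s a s') :
    A.VeeStep E {s} {s'} := by
  obtain ⟨a, ha, h⟩ := h
  obtain ⟨S', hsub, hS'⟩ := exists_veeStep_subset (A := A) (E := E) (S := {s}) (U := {s'})
    (by rintro _ rfl; exact ⟨a, ha, s', rfl, h⟩)
  rwa [(Set.subset_singleton_iff_eq.1 hsub).resolve_left
    (hS'.nonempty (Set.singleton_nonempty s)).ne_empty] at hS'

theorem IsGuide.exists_veeStep (hf : A.IsGuide en f) {t : ℕ} {S : Set A.Loc} (hS : S.Nonempty)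
    (h : ∀ s ∈ S, ((t + 1 : ℕ) : ℕ∞) < A.rank en t s) :
    ∃ S' ⊆ f t '' S, S'.Nonempty ∧ A.VeeStep (en t) S S' := by
  obtain ⟨S', hsub, hS'⟩ := exists_veeStep_subset (A := A) (E := en t) (S := S) (U := f t '' S)
    (fun s hs => by
      obtain ⟨a, ha, h⟩ := (hf t s (h s hs)).1
      exact ⟨a, ha, _, ⟨s, hs, rfl⟩, h⟩)
  exact ⟨S', hsub, hS'.nonempty hS, hS'⟩

theorem IsGuide.exists_veeStep_meets (hf : A.IsGuide en f) {t : ℕ} {S : Set A.Loc} {w : A.Loc}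
    (hS : S.Nonempty) (hw : ∀ s ∈ S, A.Meets en f t w s)
    (h : ((t + 1 : ℕ) : ℕ∞) < A.rank en t w) :
    ∃ S', S'.Nonempty ∧ (∀ s ∈ S', A.Meets en f (t + 1) (f t w) s) ∧ A.VeeStep (en t) S S' := by
  obtain ⟨S', hsub, hne, hS'⟩ := hf.exists_veeStep hS fun s hs => (hw s hs).rank_eq hf ▸ h
  refine ⟨S', hne, fun s hs => ?_, hS'⟩
  obtain ⟨s₀, hs₀, rfl⟩ := hsub hs
  exact (hw s₀ hs₀).next hf h

variable (A) in
/-- The obligations `S` before position `t` can be moved on to a set that is discharged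
at position `e`. -/
inductive CanDischarge (en : ℕ → Set (Fin n)) : ℕ → Set A.Loc → ℕ → Prop
  | now {t : ℕ} {S : Set A.Loc} (h : A.Discharges (en t) S) : CanDischarge en t S t
  | step {t e : ℕ} {S S' : Set A.Loc} (h : A.VeeStep (en t) S S')
      (hS' : CanDischarge en (t + 1) S' e) : CanDischarge en t S e

theorem CanDischarge.le {t e : ℕ} {S : Set A.Loc} (h : A.CanDischarge en t S e) : t ≤ e := by
  induction h with
  | now => exact le_rfl
  | step _ _ ih => omega

theorem CanAccept.canDischarge {t e : ℕ} {s : A.Loc} (h : A.CanAccept en t s e) :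
    A.CanDischarge en t {s} e := by
  induction h with
  | last ha h hs' => exact .now ⟨_, rfl, _, ha, _, hs', h⟩
  | step ha h _ ih => exact .step (veeStep_singleton ⟨_, ha, h⟩) ih

/-- Guided vee-steps shrink the obligations to the single location `z` after `k` steps. Its rank is
still infinite, so some accepting run from it ends at or after `M`, and a single run is a chain of
singleton vee-steps. -/
theorem IsGuide.exists_canDischarge_of_orbit (hf : A.IsGuide en f) (M : ℕ) (z : A.Loc) (k : ℕ) :
    ∀ {t : ℕ} {S : Set A.Loc}, S.Nonempty → (∀ s ∈ S, A.rank en t s = ⊤) →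
      (∀ s ∈ S, orbit f t k s = z) → ∃ e ≥ M, A.CanDischarge en t S e := by
  induction k with
  | zero =>
    intro t S hne hr hz
    obtain rfl : S = {z} := Set.eq_singleton_iff_nonempty_unique_mem.2 ⟨hne, hz⟩
    obtain ⟨e, he, h⟩ := exists_canAccept_of_lt_rank (A := A) (en := en) (t := t) (s := z) (M := M)
      (by rw [hr z rfl]; exact ENat.natCast_lt_top M)
    exact ⟨e, he, h.canDischarge⟩
  | succ k ih =>
    intro t S hne hr hz
    have hlt : ∀ s ∈ S, ((t + 1 : ℕ) : ℕ∞) < A.rank en t s := fun s hs => by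
      rw [hr s hs]; exact ENat.natCast_lt_top _
    obtain ⟨S', hsub, hne', hS'⟩ := hf.exists_veeStep hne hlt
    obtain ⟨e, he, h⟩ := ih (t := t + 1) hne'
      (fun s hs => by
        obtain ⟨s₀, hs₀, rfl⟩ := hsub hs
        rw [(hf _ _ (hlt s₀ hs₀)).2, hr s₀ hs₀])
      (fun s hs => by
        obtain ⟨s₀, hs₀, rfl⟩ := hsub hs
        exact hz s₀ hs₀)
    exact ⟨e, he, .step hS' h⟩

theorem IsGuide.exists_canDischarge (hf : A.IsGuide en f) (M : ℕ) {t : ℕ} {S : Set A.Loc}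
    {w : A.Loc} (hS : S.Nonempty) (hw : ∀ s ∈ S, A.Meets en f t w s) (h : A.rank en t w = ⊤) :
    ∃ e ≥ M, A.CanDischarge en t S e := by
  have := A.finiteLoc
  have hk : ∀ s, ∃ k, s ∈ S → ∀ l ≥ k, orbit f t l w = orbit f t l s := fun s => by
    by_cases hs : s ∈ S
    · obtain ⟨k, hk⟩ := (hw s hs).exists_orbit_eq
      exact ⟨k, fun _ => hk⟩
    · exact ⟨0, fun h => absurd h hs⟩
  choose k hk using hk
  -- Finiteness of the locations gives one delay after which all the guided runs from `S` agree.
  obtain ⟨K, hK⟩ := (Set.finite_range k).bddAbove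
  exact hf.exists_canDischarge_of_orbit M (orbit f t K w) K hS
    (fun s hs => by rw [← (hw s hs).rank_eq hf, h])
    (fun s hs => (hk s hs K (hK ⟨s, rfl⟩)).symm)

end ModalityNFA

/-! ### The strategy of a single sub-component -/

namespace ModalityNFA

variable {n : ℕ} (A : ModalityNFA n)

/-- A sub-component together with the data that guide it: the time of the last reset of its clock,
a representative of the obligations in its charge, and a position by which it discharges. -/
structure Track where
  loc : A.SubLoc
  stamp : ℝ
  rep : A.Loc
  deadline : ℕ

variable (en : ℕ → Set (Fin n)) (f : ℕ → A.Loc → A.Loc) (τ : ℕ → ℝ) (c : ℕ)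

/-- The sub-component is in a state before position `t` from which it can meet its obligations. -/
inductive Track.Good (t : ℕ) : A.Track → Prop
  | idle (b : ℝ) (w : A.Loc) (e : ℕ) : Good t ⟨(0, ∅, ∅), b, w, e⟩
  | bounded (l : Fin 4) (S : Set A.Loc) (b : ℝ) (w : A.Loc) (e : ℕ) (hl : l = 1 ∨ l = 2)
      (hS : S.Nonempty) (hw : ∀ s ∈ S, A.Meets en f t w s) (hr : A.rank en t w = (e + 1 : ℕ))
      (hb : c ≤ τ e - b) : Good t ⟨(l, S, ∅), b, w, e⟩
  | fresh (S : Set A.Loc) (b : ℝ) (w : A.Loc) (e : ℕ) (hS : S.Nonempty)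
      (hw : ∀ s ∈ S, A.Meets en f t w s) (hr : A.rank en t w = ⊤) : Good t ⟨(2, S, ∅), b, w, e⟩
  | planned (S : Set A.Loc) (b : ℝ) (w : A.Loc) (e : ℕ) (hS : A.CanDischarge en t S e)
      (hr : A.rank en t w = ⊤) (hb : c ≤ τ e - b) : Good t ⟨(1, S, ∅), b, w, e⟩
  | buffered (S T : Set A.Loc) (b : ℝ) (w : A.Loc) (e : ℕ) (hS : A.CanDischarge en t S e)
      (hT : T.Nonempty) (hw : ∀ s ∈ T, A.Meets en f t w s) (hr : A.rank en t w = ⊤)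
      (hb : c ≤ τ e - b) : Good t ⟨(3, S, T), b, w, e⟩

/-- A transition of the sub-component `x` at position `t`. -/
def Track.Moves {X : Type} (x : X) (pull : Bool) (t : ℕ) (k k' : A.Track) : Prop :=
  ∃ (g : ClockConstraint X) (r : Set X), A.SubStep (en t) c x pull k.loc g r k'.loc ∧ r ⊆ {x} ∧
    (∀ u : X → ℝ, u x = τ t - k.stamp → g.Sat u) ∧
    (x ∈ r → k'.stamp = τ t) ∧ (x ∉ r → k'.stamp = k.stamp)

variable {A}

/-- The deadline of a sub-component that is neither idle nor just restarted is kept. -/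
def Track.Keeps (k k' : A.Track) : Prop :=
  (k.loc.1 = 0 ∨ k.loc.1 = 2) ∨ (k'.loc.1 = 0 ∨ k'.loc.1 = 2) ∨ k'.deadline = k.deadline

variable {en f τ c} {t : ℕ} {k : A.Track}

namespace Track.Good

theorem lt_rank (h : k.Good A en f τ c t) (hk : k.loc.1 ≠ 0) :
    (t : ℕ∞) < A.rank en t k.rep := by
  cases h with
  | idle => exact absurd rfl hk
  | bounded l S b w e hl hS hw => obtain ⟨s, hs⟩ := hS; exact (hw s hs).lt_rank
  | fresh S b w e hS hw hr => simp [hr]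
  | planned S b w e hS hr => simp [hr]
  | buffered S T b w e hS hT hw hr => simp [hr]

theorem le_deadline (h : k.Good A en f τ c t) (h0 : k.loc.1 ≠ 0) (h2 : k.loc.1 ≠ 2) :
    t ≤ k.deadline := by
  have hlt := h.lt_rank h0
  cases h with
  | idle => exact absurd rfl h0
  | bounded l S b w e hl hS hw hr =>
    rw [hr] at hlt
    have : t < e + 1 := by exact_mod_cast hlt
    simp only
    omega
  | fresh => exact absurd rfl h2
  | planned S b w e hS hr => exact hS.le
  | buffered S T b w e hS hT hw hr => exact hS.le

theorem exists_planned (hf : A.IsGuide en f) (hτ : ∀ r, ∃ j, r ≤ τ j) (hmono : Monotone τ)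
    {S : Set A.Loc} {w : A.Loc} (b : ℝ) (hS : S.Nonempty)
    (hw : ∀ s ∈ S, A.Meets en f t w s) (hr : A.rank en t w = ⊤) :
    ∃ e, Good A en f τ c t ⟨(1, S, ∅), b, w, e⟩ := by
  obtain ⟨M, hM⟩ := hτ (c + b)
  obtain ⟨e, he, h⟩ := hf.exists_canDischarge M hS hw hr
  exact ⟨e, .planned S b w e h hr (by linarith [hmono he])⟩

/-- At its last acceptance position the class has collapsed to the representative, and the supremum
defining a finite rank is attained. -/
theorem discharges_of_rank_eq {S : Set A.Loc} {w : A.Loc} (hS : S.Nonempty)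
    (hw : ∀ s ∈ S, A.Meets en f t w s) (hr : A.rank en t w = (t + 1 : ℕ)) :
    A.Discharges (en t) S := by
  obtain rfl : S = {w} := Set.eq_singleton_iff_nonempty_unique_mem.2
    ⟨hS, fun s hs => ((hw s hs).eq_of_rank_eq hr).symm⟩
  cases canAccept_of_rank_eq hr with
  | last ha h hs' => exact ⟨w, rfl, _, ha, _, hs', h⟩
  | step _ _ h => have := h.le; omega

theorem cast_succ_lt_of_ne {t e : ℕ} (h : (t : ℕ∞) < (e + 1 : ℕ)) (hne : e ≠ t) :
    ((t + 1 : ℕ) : ℕ∞) < (e + 1 : ℕ) := by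
  have : t < e + 1 := by exact_mod_cast h
  exact_mod_cast (by omega : t + 1 < e + 1)

section

variable {X : Type} (x : X)

theorem moves_of_keep {pull : Bool} {q q' : A.SubLoc} {b : ℝ} {w w' : A.Loc} {e e' : ℕ}
    (h : A.SubStep (en t) c x pull q .top ∅ q') :
    Track.Moves A en τ c x pull t ⟨q, b, w, e⟩ ⟨q', b, w', e'⟩ :=
  ⟨_, _, h, Set.empty_subset _, fun _ _ => trivial, fun h => absurd h (Set.notMem_empty x),
    fun _ => rfl⟩

theorem moves_of_reset {pull : Bool} {q q' : A.SubLoc} {b : ℝ} {w w' : A.Loc} {e e' : ℕ}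
    (h : A.SubStep (en t) c x pull q .top {x} q') :
    Track.Moves A en τ c x pull t ⟨q, b, w, e⟩ ⟨q', τ t, w', e'⟩ :=
  ⟨_, _, h, subset_rfl, fun _ _ => trivial, fun _ => rfl, fun h => absurd rfl h⟩

theorem moves_of_guard {pull : Bool} {q q' : A.SubLoc} {b : ℝ} {w w' : A.Loc} {e e' : ℕ}
    (h : A.SubStep (en t) c x pull q (.cmp x .ge c) ∅ q') (hb : c ≤ τ t - b) :
    Track.Moves A en τ c x pull t ⟨q, b, w, e⟩ ⟨q', b, w', e'⟩ :=
  ⟨_, _, h, Set.empty_subset _, fun u hu => show u x ≥ c from hu ▸ hb,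
    fun h => absurd h (Set.notMem_empty x), fun _ => rfl⟩

theorem moves_of_guard_reset {pull : Bool} {q q' : A.SubLoc} {b : ℝ} {w w' : A.Loc} {e e' : ℕ}
    (h : A.SubStep (en t) c x pull q (.cmp x .ge c) {x} q') (hb : c ≤ τ t - b) :
    Track.Moves A en τ c x pull t ⟨q, b, w, e⟩ ⟨q', τ t, w', e'⟩ :=
  ⟨_, _, h, subset_rfl, fun u hu => show u x ≥ c from hu ▸ hb, fun _ => rfl,
    fun h => absurd rfl h⟩

theorem next_rank (hf : A.IsGuide en f) {w : A.Loc} (hr : A.rank en t w = ⊤) :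
    A.rank en (t + 1) (f t w) = ⊤ := by
  rw [(hf t w (by rw [hr]; exact ENat.natCast_lt_top _)).2, hr]

/-- A good sub-component can move on without taking charge of a trigger. -/
theorem exists_moves_false (hf : A.IsGuide en f) (hτ : ∀ r, ∃ j, r ≤ τ j) (hmono : Monotone τ)
    (h : k.Good A en f τ c t) :
    ∃ k' : A.Track, k.Moves A en τ c x false t k' ∧ k'.Good A en f τ c (t + 1) ∧ k.Keeps k' ∧
      (k'.loc.1 ≠ 0 → k.loc.1 ≠ 0 ∧ ((t + 1 : ℕ) : ℕ∞) < A.rank en t k.rep ∧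
        k'.rep = f t k.rep) := by
  have htop : ∀ {w : A.Loc}, A.rank en t w = ⊤ → ((t + 1 : ℕ) : ℕ∞) < A.rank en t w :=
    fun hr => by rw [hr]; exact ENat.natCast_lt_top _
  cases h with
  | idle b w e =>
    exact ⟨⟨(0, ∅, ∅), b, w, e⟩, moves_of_keep x .idle, .idle b w e, .inl (.inl rfl),
      fun h => absurd rfl h⟩
  | bounded l S b w e hl hS hw hr hb =>
    have hlt : (t : ℕ∞) < (e + 1 : ℕ) := by
      obtain ⟨s, hs⟩ := hS
      exact hr ▸ (hw s hs).lt_rank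
    have hl0 : l ≠ 0 := by rcases hl with rfl | rfl <;> decide
    by_cases he : e = t
    · subst he
      exact ⟨⟨(0, ∅, ∅), b, w, e⟩,
        moves_of_guard x (.finish l S hl (discharges_of_rank_eq hS hw hr)) hb, .idle b w e,
        .inr (.inl (.inl rfl)), fun h => absurd rfl h⟩
    · have hlt' := cast_succ_lt_of_ne hlt he
      rw [← hr] at hlt'
      obtain ⟨S', hne, hw', hS'⟩ := hf.exists_veeStep_meets hS hw hlt'
      exact ⟨⟨(1, S', ∅), b, f t w, e⟩, moves_of_keep x (.wait l S S' hl hS'),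
        .bounded 1 S' b _ e (.inl rfl) hne hw' ((hf t w hlt').2.trans hr) hb, .inr (.inr rfl),
        fun _ => ⟨hl0, hlt', rfl⟩⟩
  | fresh S b w e hS hw hr =>
    obtain ⟨S', hne, hw', hS'⟩ := hf.exists_veeStep_meets hS hw (htop hr)
    -- The plan is made only on leaving `ℓ = 2`: a trigger arriving there is merged with a reset,
    -- which could invalidate a plan made earlier.
    obtain ⟨e', h'⟩ := exists_planned (c := c) hf hτ hmono b hne hw' (next_rank hf hr)
    exact ⟨_, moves_of_keep x (.wait 2 S S' (.inr rfl) hS'), h', .inl (.inr rfl),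
      fun _ => ⟨by simp, htop hr, rfl⟩⟩
  | planned S b w e hS hr hb =>
    cases hS with
    | now hS =>
      exact ⟨⟨(0, ∅, ∅), b, w, t⟩, moves_of_guard x (.finish 1 S (.inl rfl) hS) hb, .idle b w t,
        .inr (.inl (.inl rfl)), fun h => absurd rfl h⟩
    | @step _ _ _ S' h hS' =>
      -- `S'` follows the plan, not the guide; the representative keeps to the guide and merely
      -- marks the class being served.
      exact ⟨⟨(1, S', ∅), b, f t w, e⟩, moves_of_keep x (.wait 1 S S' (.inl rfl) h),
        .planned S' b _ e hS' (next_rank hf hr) hb, .inr (.inr rfl),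
        fun _ => ⟨by simp, htop hr, rfl⟩⟩
  | buffered S T b w e hS hT hw hr hb =>
    obtain ⟨T', hne, hw', hT'⟩ := hf.exists_veeStep_meets hT hw (htop hr)
    cases hS with
    | now hS =>
      exact ⟨⟨(2, T', ∅), τ t, f t w, t⟩, moves_of_guard_reset x (.finishBuffered S T T' hT' hS) hb,
        .fresh T' _ _ t hne hw' (next_rank hf hr), .inr (.inl (.inr rfl)),
        fun _ => ⟨by simp, htop hr, rfl⟩⟩
    | @step _ _ _ S' h hS' =>
      exact ⟨⟨(3, S', T'), b, f t w, e⟩, moves_of_keep x (.waitBuffered S S' T T' h hT'),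
        .buffered S' T' b _ e hS' hne hw' (next_rank hf hr) hb, .inr (.inr rfl),
        fun _ => ⟨by simp, htop hr, rfl⟩⟩

/-- A trigger whose guided run meets that of the representative is merged or buffered. -/
theorem exists_moves_true_of_meets (hf : A.IsGuide en f) (hτ : ∀ r, ∃ j, r ≤ τ j)
    (hmono : Monotone τ) (h : k.Good A en f τ c t) (hk : k.loc.1 ≠ 0)
    (hm : A.Meets en f t k.rep A.init) (hi : ((t + 1 : ℕ) : ℕ∞) < A.rank en t A.init)
    (hc : ∀ e, A.rank en t A.init = (e + 1 : ℕ) → c ≤ τ e - τ t) :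
    ∃ k' : A.Track, k.Moves A en τ c x true t k' ∧ k'.Good A en f τ c (t + 1) ∧ k.Keeps k' ∧
      k'.rep = f t k.rep := by
  have hri := hm.rank_eq hf
  rw [← hri] at hi hc
  have hm' := hm.next hf hi
  have hV := veeStep_singleton (hf t A.init (hri ▸ hi)).1
  have hunion : ∀ {U : Set A.Loc}, (∀ s ∈ U, A.Meets en f (t + 1) (f t k.rep) s) →
      ∀ s ∈ U ∪ {f t A.init}, A.Meets en f (t + 1) (f t k.rep) s := by
    rintro U hU s (hs | rfl)
    exacts [hU s hs, hm']
  have hsing : ∀ s ∈ ({f t A.init} : Set A.Loc), A.Meets en f (t + 1) (f t k.rep) s := by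
    rintro s rfl
    exact hm'
  cases h with
  | idle => exact absurd rfl hk
  | bounded l S b w e hl hS hw hr hb =>
    obtain ⟨S', hne, hw', hS'⟩ := hf.exists_veeStep_meets hS hw hi
    -- The trigger has the rank of the representative, so the deadline `e` is unchanged, and `hc`
    -- shows that it satisfies the guard even after the reset.
    exact ⟨⟨(1, S' ∪ {f t A.init}, ∅), τ t, f t w, e⟩,
      moves_of_reset x (.pullMerge l S S' _ hl hS' hV),
      .bounded 1 _ _ _ e (.inl rfl) hne.inl (hunion hw') ((hf t w hi).2.trans hr) (hc e hr),
      .inr (.inr rfl), rfl⟩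
  | fresh S b w e hS hw hr =>
    obtain ⟨S', hne, hw', hS'⟩ := hf.exists_veeStep_meets hS hw hi
    obtain ⟨e', h'⟩ := exists_planned (c := c) hf hτ hmono (τ t) (hne.inl (t := {f t A.init}))
      (hunion hw') (next_rank hf hr)
    exact ⟨_, moves_of_reset x (.pullMerge 2 S S' _ (.inr rfl) hS' hV), h', .inl (.inr rfl), rfl⟩
  | planned S b w e hS hr hb =>
    cases hS with
    | now hS =>
      -- The planned discharge falls on the trigger position, so only the new obligation remains.
      exact ⟨⟨(2, {f t A.init}, ∅), τ t, f t w, t⟩,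
        moves_of_guard_reset x (.pullFinish 1 S _ (.inl rfl) hV hS) hb,
        .fresh _ _ _ t (Set.singleton_nonempty _) hsing (next_rank hf hr),
        .inr (.inl (.inr rfl)), rfl⟩
    | @step _ _ _ S' h hS' =>
      exact ⟨⟨(3, S', {f t A.init}), b, f t w, e⟩, moves_of_keep x (.pullOpenBuffer S S' _ h hV),
        .buffered S' _ b _ e hS' (Set.singleton_nonempty _) hsing (next_rank hf hr) hb,
        .inr (.inr rfl), rfl⟩
  | buffered S T b w e hS hT hw hr hb =>
    obtain ⟨T', hne, hw', hT'⟩ := hf.exists_veeStep_meets hT hw hi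
    cases hS with
    | now hS =>
      exact ⟨⟨(2, T' ∪ {f t A.init}, ∅), τ t, f t w, t⟩,
        moves_of_guard_reset x (.pullFinishBuffered S T T' _ hT' hV hS) hb,
        .fresh _ _ _ t hne.inl (hunion hw') (next_rank hf hr),
        .inr (.inl (.inr rfl)), rfl⟩
    | @step _ _ _ S' h hS' =>
      exact ⟨⟨(3, S', T' ∪ {f t A.init}), b, f t w, e⟩,
        moves_of_keep x (.pullBuffer S S' T T' _ h hT' hV),
        .buffered S' _ b _ e hS' hne.inl (hunion hw') (next_rank hf hr) hb,
        .inr (.inr rfl), rfl⟩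

/-- A sub-component that may become idle can take charge of a trigger instead. -/
theorem exists_moves_true_of_idle (hf : A.IsGuide en f) (hτ : ∀ r, ∃ j, r ≤ τ j)
    (hmono : Monotone τ) {k₀ : A.Track} (h : k.Moves A en τ c x false t k₀) (h₀ : k₀.loc.1 = 0)
    (hi : ((t + 1 : ℕ) : ℕ∞) < A.rank en t A.init)
    (hc : ∀ e, A.rank en t A.init = (e + 1 : ℕ) → c ≤ τ e - τ t) :
    ∃ k' : A.Track, k.Moves A en τ c x true t k' ∧ k'.Good A en f τ c (t + 1) ∧ k.Keeps k' ∧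
      k'.rep = f t A.init := by
  have hV := veeStep_singleton (hf t A.init hi).1
  have hr' := (hf t A.init hi).2
  have hsing : ∀ s ∈ ({f t A.init} : Set A.Loc), A.Meets en f (t + 1) (f t A.init) s := by
    rintro s rfl
    exact .refl (hr' ▸ hi)
  have hne := Set.singleton_nonempty (f t A.init)
  obtain ⟨q, b, w, d⟩ := k
  obtain ⟨q₀, b₀, w₀, d₀⟩ := k₀
  obtain ⟨g, r, hstep, -, hg, -, -⟩ := h
  simp only at hstep h₀
  by_cases htop : A.rank en t A.init = ⊤
  -- Only `idle` and `finish` lead to `ℓ = 0`; their trigger counterparts are `pullStart` and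
  -- `pullFinish`. The deadline `0` given after `pullFinish` is a dummy, as none is in force at `ℓ =
  -- 2` with infinite rank.
  · cases hstep with
    | idle =>
      obtain ⟨e, h'⟩ := exists_planned (c := c) hf hτ hmono (τ t) hne hsing (next_rank hf htop)
      exact ⟨_, moves_of_reset x (.pullStart _ hV), h', .inl (.inl rfl), rfl⟩
    | finish l S hl hS =>
      exact ⟨⟨(2, {f t A.init}, ∅), τ t, f t A.init, 0⟩,
        moves_of_guard_reset x (.pullFinish l S _ hl hV hS) (hg (fun _ => τ t - b) rfl),
        .fresh _ _ _ _ hne hsing (next_rank hf htop), .inr (.inl (.inr rfl)), rfl⟩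
    | wait | waitBuffered | finishBuffered => exact absurd h₀ (by simp)
  · obtain ⟨e, he⟩ : ∃ e : ℕ, A.rank en t A.init = (e + 1 : ℕ) := by
      obtain ⟨N, hN⟩ := ENat.ne_top_iff_exists.1 htop
      rw [← hN] at hi
      have : t + 1 < N := by exact_mod_cast hi
      -- The rank is the last acceptance position plus one, and it is positive by `hi`.
      exact ⟨N - 1, by rw [← hN]; congr; omega⟩
    cases hstep with
    | idle =>
      exact ⟨_, moves_of_reset x (.pullStart _ hV),
        .bounded 1 _ _ _ e (.inl rfl) hne hsing (hr'.trans he) (hc e he), .inl (.inl rfl), rfl⟩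
    | finish l S hl hS =>
      exact ⟨_, moves_of_guard_reset x (.pullFinish l S _ hl hV hS) (hg (fun _ => τ t - b) rfl),
        .bounded 2 _ _ _ e (.inr rfl) hne hsing (hr'.trans he) (hc e he),
        .inr (.inl (.inr rfl)), rfl⟩
    | wait | waitBuffered | finishBuffered => exact absurd h₀ (by simp)

end

end Track.Good

end ModalityNFA

/-! ### Coordinating the sub-components -/

namespace ModalityNFA

variable {n : ℕ} {A : ModalityNFA n} {en : ℕ → Set (Fin n)} {f : ℕ → A.Loc → A.Loc} {τ : ℕ → ℝ}
  {c t : ℕ}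

theorem SubStep.reset_subset {E : Set (Fin n)} {X : Type} {x : X} {b : Bool} {q q' : A.SubLoc}
    {g : ClockConstraint X} {r : Set X} (h : A.SubStep E c x b q g r q') : r ⊆ {x} := by
  cases h <;> simp

theorem SubStep.sat_congr {E : Set (Fin n)} {X : Type} {x : X} {b : Bool} {q q' : A.SubLoc}
    {g : ClockConstraint X} {r : Set X} (h : A.SubStep E c x b q g r q') {u u' : X → ℝ}
    (hu : u x = u' x) (hg : g.Sat u) : g.Sat u' := by
  cases h <;> simp_all [ClockConstraint.Sat]

variable (A en f τ c) in
/-- All sub-components are good and the obligations of different ones never meet. -/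
def GoodConfig (t : ℕ) (K : Fin (Nat.card A.Loc) → A.Track) : Prop :=
  (∀ j, (K j).Good A en f τ c t) ∧
    ∀ i j, i ≠ j → (K i).loc.1 ≠ 0 → (K j).loc.1 ≠ 0 → ¬ A.Meets en f t (K i).rep (K j).rep

/-- Pigeonhole: if all stayed busy, the guided successors of their representatives would be pairwise
distinct and exhaust the locations, so one would equal the guided successor of `A.init` and the
trigger would meet that class. -/
theorem GoodConfig.exists_idle (hf : A.IsGuide en f) {K K₀ : Fin (Nat.card A.Loc) → A.Track}
    (hK : GoodConfig A en f τ c t K)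
    (h₀ : ∀ j, (K₀ j).loc.1 ≠ 0 → (K j).loc.1 ≠ 0 ∧
      ((t + 1 : ℕ) : ℕ∞) < A.rank en t (K j).rep ∧ (K₀ j).rep = f t (K j).rep)
    (hi : ((t + 1 : ℕ) : ℕ∞) < A.rank en t A.init)
    (hno : ∀ j, (K j).loc.1 ≠ 0 → ¬ A.Meets en f t (K j).rep A.init) :
    ∃ j, (K₀ j).loc.1 = 0 := by
  by_contra! hall
  have := A.finiteLoc
  have hmeet : ∀ {s s' : A.Loc}, ((t + 1 : ℕ) : ℕ∞) < A.rank en t s →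
      ((t + 1 : ℕ) : ℕ∞) < A.rank en t s' → f t s = f t s' → A.Meets en f t s s' :=
    fun hs hs' h => .step hs hs' (h ▸ .refl (by rwa [(hf _ _ hs).2]))
  have hinj : Function.Injective fun j => f t (K j).rep := fun i j hij => by
    by_contra hne
    obtain ⟨hi1, hi2, -⟩ := h₀ i (hall i)
    obtain ⟨hj1, hj2, -⟩ := h₀ j (hall j)
    exact hK.2 i j hne hi1 hj1 (hmeet hi2 hj2 hij)
  obtain ⟨j, hj⟩ := (hinj.bijective_of_nat_card_le (by simp)).surjective (f t A.init)
  obtain ⟨hj1, hj2, -⟩ := h₀ j (hall j)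
  exact hno j hj1 (hmeet hj2 hi hj)

theorem GoodConfig.exists_next (hf : A.IsGuide en f) (hτ : ∀ r, ∃ j, r ≤ τ j)
    (hmono : Monotone τ) {K : Fin (Nat.card A.Loc) → A.Track} (hK : GoodConfig A en f τ c t K)
    (P : Prop) (hP : P → ∃ e, t < e ∧ A.CanAccept en t A.init e ∧ c ≤ τ e - τ t) :
    ∃ K' : Fin (Nat.card A.Loc) → A.Track, GoodConfig A en f τ c (t + 1) K' ∧
      (∀ j, (K j).Keeps (K' j)) ∧
      ∃ pull : Fin (Nat.card A.Loc) → Bool,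
        (P → ∃! j, pull j = true) ∧ (¬ P → ∀ j, pull j = false) ∧
          ∀ j, (K j).Moves A en τ c j (pull j) t (K' j) := by
  choose K₀ hmov hgood hkeep hrep using
    fun j => (hK.1 j).exists_moves_false j hf hτ hmono
  -- Runs that meet after a guided step already meet before it, so separated classes stay separated.
  have hsep : ∀ i j, i ≠ j → (K₀ i).loc.1 ≠ 0 → (K j).loc.1 ≠ 0 →
      ((t + 1 : ℕ) : ℕ∞) < A.rank en t (K j).rep →
      ¬ A.Meets en f (t + 1) (K₀ i).rep (f t (K j).rep) := by
    intro i j hij hi hj1 hj2 hm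
    obtain ⟨hi1, hi2, hi3⟩ := hrep i hi
    rw [hi3] at hm
    exact hK.2 i j hij hi1 hj1 (.step hi2 hj2 hm)
  by_cases hp : P
  swap
  · refine ⟨K₀, ⟨hgood, fun i j hij hi hj => ?_⟩, hkeep, fun _ => false, fun h => absurd h hp,
      fun _ _ => rfl, hmov⟩
    obtain ⟨hj1, hj2, hj3⟩ := hrep j hj
    rw [hj3]
    exact hsep i j hij hi hj1 hj2
  obtain ⟨e, hte, hacc, hce⟩ := hP hp
  have hi : ((t + 1 : ℕ) : ℕ∞) < A.rank en t A.init :=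
    lt_of_le_of_lt (by exact_mod_cast hte) hacc.lt_rank
  -- The last acceptance position is no earlier than the witness `e`, so it meets the time bound
  -- too.
  have hc : ∀ e', A.rank en t A.init = (e' + 1 : ℕ) → c ≤ τ e' - τ t := fun e' he' => by
    have h := hacc.lt_rank
    rw [he'] at h
    have : e < e' + 1 := by exact_mod_cast h
    linarith [hmono (by omega : e ≤ e')]
  -- It is enough to replace the non-trigger move of one sub-component by a trigger move whose class
  -- stays apart from the others.
  suffices h : ∃ (j : Fin (Nat.card A.Loc)) (k' : A.Track),
      (K j).Moves A en τ c j true t k' ∧ k'.Good A en f τ c (t + 1) ∧ (K j).Keeps k' ∧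
        ∀ i, i ≠ j → (K₀ i).loc.1 ≠ 0 → ¬ A.Meets en f (t + 1) (K₀ i).rep k'.rep by
    obtain ⟨j, k', hm, hg, hk, hs⟩ := h
    have hupd : ∀ (Q : Fin (Nat.card A.Loc) → A.Track → Prop), Q j k' → (∀ i, Q i (K₀ i)) →
        ∀ i, Q i (Function.update K₀ j k' i) := fun Q h1 h2 i => by
      by_cases h : i = j
      · subst h; rwa [Function.update_self]
      · rw [Function.update_of_ne h]; exact h2 i
    refine ⟨Function.update K₀ j k', ⟨hupd (fun _ k => k.Good A en f τ c (t + 1)) hg hgood, ?_⟩,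
      hupd (fun i k => (K i).Keeps k) hk hkeep, fun i => decide (i = j),
      fun _ => ⟨j, by simp, fun i hi => by simpa using hi⟩, fun h => absurd hp h, fun i => ?_⟩
    · intro i i' hne hi1 hi2
      by_cases h : i = j
      · subst h
        rw [Function.update_of_ne hne.symm] at hi2 ⊢
        rw [Function.update_self]
        exact fun hm => hs i' hne.symm hi2 hm.symm
      · rw [Function.update_of_ne h] at hi1 ⊢
        by_cases h' : i' = j
        · subst h'
          rw [Function.update_self]
          exact hs i h hi1
        · rw [Function.update_of_ne h'] at hi2 ⊢
          obtain ⟨hj1, hj2, hj3⟩ := hrep i' hi2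
          rw [hj3]
          exact hsep i i' hne hi1 hj1 hj2
    · by_cases h : i = j
      · subst h; simpa using hm
      · simpa [h] using hmov i
  by_cases hex : ∃ j, (K j).loc.1 ≠ 0 ∧ A.Meets en f t (K j).rep A.init
  · obtain ⟨j, hj, hm⟩ := hex
    obtain ⟨k', h1, h2, h3, h4⟩ :=
      (hK.1 j).exists_moves_true_of_meets j hf hτ hmono hj hm hi hc
    refine ⟨j, k', h1, h2, h3, fun i hij hi' => ?_⟩
    rw [h4]
    exact hsep i j hij hi' hj (by rwa [hm.rank_eq hf])
  · push Not at hex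
    obtain ⟨j, hj⟩ := hK.exists_idle hf hrep hi hex
    obtain ⟨k', h1, h2, h3, h4⟩ :=
      Track.Good.exists_moves_true_of_idle j hf hτ hmono (hmov j) hj hi hc
    refine ⟨j, k', h1, h2, h3, fun i _ hi' hm => ?_⟩
    obtain ⟨hi1, hi2, hi3⟩ := hrep i hi'
    rw [h4, hi3] at hm
    exact hex i hi1 (.step hi2 hi hm)

/-- Away from `ℓ = 0` and `ℓ = 2` the deadline is constant and bounds the current position, which
cannot last. -/
theorem Track.Keeps.frequently {k : ℕ → A.Track} (hg : ∀ t, (k t).Good A en f τ c t)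
    (hk : ∀ t, (k t).Keeps (k (t + 1))) (N : ℕ) : ∃ i ≥ N, (k i).loc.1 = 0 ∨ (k i).loc.1 = 2 := by
  by_contra! h
  have hd : ∀ d, (k (N + d)).deadline = (k N).deadline := by
    intro d
    induction d with
    | zero => rfl
    | succ d ih =>
      obtain ⟨h0, h2⟩ := h (N + d) (by omega)
      obtain ⟨h0', h2'⟩ := h (N + (d + 1)) (by omega)
      rcases hk (N + d) with (h' | h') | (h' | h') | h'
      · exact absurd h' h0
      · exact absurd h' h2
      · exact absurd h' h0'
      · exact absurd h' h2'
      · exact h'.trans ih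
  obtain ⟨h0, h2⟩ := h (N + ((k N).deadline + 1)) (by omega)
  have := (hg _).le_deadline h0 h2
  rw [hd] at this
  omega

theorem exists_tracks (hτ : ∀ r, ∃ j, r ≤ τ j) (hmono : Monotone τ) (P : ℕ → Prop)
    (hP : ∀ t, P t → ∃ e, t < e ∧ A.CanAccept en t A.init e ∧ c ≤ τ e - τ t) :
    ∃ K : ℕ → Fin (Nat.card A.Loc) → A.Track,
      (∀ j, (K 0 j).loc = (0, ∅, ∅) ∧ (K 0 j).stamp = 0) ∧
      (∀ t, ∃ pull : Fin (Nat.card A.Loc) → Bool,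
        (P t → ∃! j, pull j = true) ∧ (¬ P t → ∀ j, pull j = false) ∧
          ∀ j, (K t j).Moves A en τ c j (pull j) t (K (t + 1) j)) ∧
      ∀ j N, ∃ i ≥ N, (K i j).loc.1 = 0 ∨ (K i j).loc.1 = 2 := by
  obtain ⟨f, hf⟩ := exists_isGuide A en
  have hstep : ∀ t (K : {K // GoodConfig A en f τ c t K}),
      ∃ K' : {K // GoodConfig A en f τ c (t + 1) K}, (∀ j, (K.1 j).Keeps (K'.1 j)) ∧
      ∃ pull : Fin (Nat.card A.Loc) → Bool,
        (P t → ∃! j, pull j = true) ∧ (¬ P t → ∀ j, pull j = false) ∧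
          ∀ j, (K.1 j).Moves A en τ c j (pull j) t (K'.1 j) := fun t K => by
    obtain ⟨K', h, h'⟩ := K.2.exists_next hf hτ hmono (P t) (hP t)
    exact ⟨⟨K', h⟩, h'⟩
  choose F hkeep hpull using hstep
  let K : ∀ t, {K // GoodConfig A en f τ c t K} := fun t => Nat.rec
    ⟨fun _ => ⟨(0, ∅, ∅), 0, A.init, 0⟩, fun _ => .idle _ _ _, fun _ _ _ h => absurd rfl h⟩ F t
  exact ⟨fun t => (K t).1, fun j => ⟨rfl, rfl⟩, fun t => hpull t (K t), fun j N =>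
    Track.Keeps.frequently (fun t => (K t).2.1 j) (fun t => hkeep t (K t) j) N⟩

/-! ### Soundness: tracing an obligation -/

section Soundness

variable {X : Type} {x : X} {k : ℕ → A.Track}

/-- Induction on the distance to the next visit to `ℓ = 0` or `ℓ = 2`. Until `S` is discharged, `s`
has a successor in the next set; a discharged set is a singleton, so the traced location itself
accepts. Resets only move the stamp later, which makes the guard stronger than the bound measured
from `i`. -/
theorem exists_canAccept_of_mem_fst (hmono : Monotone τ)
    (hk : ∀ t, ∃ b, (k t).Moves A en τ c x b t (k (t + 1))) {i N : ℕ}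
    (hN : (k (N + 1)).loc.1 = 0 ∨ (k (N + 1)).loc.1 = 2) (d : ℕ) :
    ∀ {t : ℕ} {s : A.Loc}, t + d = N → i ≤ t → s ∈ (k t).loc.2.1 → τ i ≤ (k t).stamp →
      ∃ e, A.CanAccept en t s e ∧ c ≤ τ e - τ i := by
  induction d with
  | zero =>
    rintro t s rfl hit hs hst
    obtain ⟨b, g, r, hstep, -, hg, -, -⟩ := hk t
    have hfin : ∀ {S : Set A.Loc}, s ∈ S → A.Discharges (en t) S → c ≤ τ t - (k t).stamp →
        ∃ e, A.CanAccept en t s e ∧ c ≤ τ e - τ i := by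
      rintro S hs ⟨s', rfl, a, ha, s'', hs'', h⟩ hcs
      obtain rfl : s = s' := hs
      exact ⟨t, .last ha h hs'', by linarith⟩
    have hg' := hg (fun _ => τ t - (k t).stamp) rfl
    simp only [add_zero] at hN
    generalize k (t + 1) = k' at hstep hN
    obtain ⟨q', _, _, _⟩ := k'
    generalize (k t).loc = q at hstep hs
    simp only at hstep hN
    cases hstep with
    | idle => exact absurd hs (Set.notMem_empty s)
    | pullStart => exact absurd hs (Set.notMem_empty s)
    | wait | waitBuffered | pullMerge | pullOpenBuffer | pullBuffer => simp at hN
    | finish _ _ _ hS => exact hfin hs hS hg'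
    | finishBuffered _ _ _ _ hS => exact hfin hs hS hg'
    | pullFinish _ _ _ _ _ hS => exact hfin hs hS hg'
    | pullFinishBuffered _ _ _ _ _ _ hS => exact hfin hs hS hg'
  | succ d ih =>
    rintro t s htd hit hs hst
    obtain ⟨b, g, r, hstep, -, hg, hr, hr'⟩ := hk t
    have hst' : τ i ≤ (k (t + 1)).stamp := by
      by_cases hx : x ∈ r
      · rw [hr hx]; exact hmono hit
      · rwa [hr' hx]
    have hmov : ∀ {S S' : Set A.Loc}, s ∈ S → A.VeeStep (en t) S S' →
        S' ⊆ (k (t + 1)).loc.2.1 → ∃ e, A.CanAccept en t s e ∧ c ≤ τ e - τ i := by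
      intro S S' hs hS hsub
      obtain ⟨a, ha, s', hs', h⟩ := hS.prop s hs
      obtain ⟨e, he, hce⟩ := ih (by omega) (by omega) (hsub hs') hst'
      exact ⟨e, .step ha h he, hce⟩
    have hfin : ∀ {S : Set A.Loc}, s ∈ S → A.Discharges (en t) S → c ≤ τ t - (k t).stamp →
        ∃ e, A.CanAccept en t s e ∧ c ≤ τ e - τ i := by
      rintro S hs ⟨s', rfl, a, ha, s'', hs'', h⟩ hcs
      obtain rfl : s = s' := hs
      exact ⟨t, .last ha h hs'', by linarith⟩
    have hg' := hg (fun _ => τ t - (k t).stamp) rfl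
    generalize (k t).loc = q at hstep hs
    generalize (k (t + 1)).loc = q' at hstep hmov
    cases hstep with
    | idle => exact absurd hs (Set.notMem_empty s)
    | pullStart => exact absurd hs (Set.notMem_empty s)
    | wait _ _ _ _ hS => exact hmov hs hS subset_rfl
    | waitBuffered _ _ _ _ hS => exact hmov hs hS subset_rfl
    | pullMerge _ _ _ _ _ hS => exact hmov hs hS Set.subset_union_left
    | pullOpenBuffer _ _ _ hS => exact hmov hs hS subset_rfl
    | pullBuffer _ _ _ _ _ hS => exact hmov hs hS subset_rfl
    | finish _ _ _ hS => exact hfin hs hS hg'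
    | finishBuffered _ _ _ _ hS => exact hfin hs hS hg'
    | pullFinish _ _ _ _ _ hS => exact hfin hs hS hg'
    | pullFinishBuffered _ _ _ _ _ _ hS => exact hfin hs hS hg'

theorem exists_canAccept_of_mem_fst' (hmono : Monotone τ)
    (hk : ∀ t, ∃ b, (k t).Moves A en τ c x b t (k (t + 1)))
    (hinf : ∀ N, ∃ i ≥ N, (k i).loc.1 = 0 ∨ (k i).loc.1 = 2) {i : ℕ} {s : A.Loc} (hit : i ≤ t)
    (hs : s ∈ (k t).loc.2.1) (hst : τ i ≤ (k t).stamp) :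
    ∃ e, A.CanAccept en t s e ∧ c ≤ τ e - τ i := by
  obtain ⟨N, hN, h⟩ := hinf (t + 1)
  obtain ⟨d, rfl⟩ := Nat.exists_eq_add_of_le hN
  exact exists_canAccept_of_mem_fst hmono hk (N := t + d)
    (by rwa [show t + d + 1 = t + 1 + d by ring]) d rfl hit hs hst

/-- No bound on the stamp is needed: the buffer becomes the first set only in a transition that
resets the clock, at a position no earlier than `i`. From there `exists_canAccept_of_mem_fst'` takes
over. -/
theorem exists_canAccept_of_mem_snd (hmono : Monotone τ)
    (hk : ∀ t, ∃ b, (k t).Moves A en τ c x b t (k (t + 1)))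
    (hinf : ∀ N, ∃ i ≥ N, (k i).loc.1 = 0 ∨ (k i).loc.1 = 2) {i N : ℕ}
    (hN : (k N).loc.1 = 0 ∨ (k N).loc.1 = 2) (d : ℕ) :
    ∀ {t : ℕ} {s : A.Loc}, t + d = N → i ≤ t → (k t).loc.1 = 3 → s ∈ (k t).loc.2.2 →
      ∃ e, A.CanAccept en t s e ∧ c ≤ τ e - τ i := by
  induction d with
  | zero =>
    rintro t s rfl _ h3
    simp [h3] at hN
  | succ d ih =>
    rintro t s htd hit h3 hs
    obtain ⟨b, g, r, hstep, -, hg, hr, hr'⟩ := hk t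
    have hmov : ∀ {T T' : Set A.Loc}, s ∈ T → A.VeeStep (en t) T T' →
        (k (t + 1)).loc.1 = 3 → T' ⊆ (k (t + 1)).loc.2.2 →
        ∃ e, A.CanAccept en t s e ∧ c ≤ τ e - τ i := by
      intro T T' hs hT h3' hsub
      obtain ⟨a, ha, s', hs', h⟩ := hT.prop s hs
      obtain ⟨e, he, hce⟩ := ih (by omega) (by omega) h3' (hsub hs')
      exact ⟨e, .step ha h he, hce⟩
    have hshift : ∀ {T T' : Set A.Loc}, s ∈ T → A.VeeStep (en t) T T' → x ∈ r →
        T' ⊆ (k (t + 1)).loc.2.1 → ∃ e, A.CanAccept en t s e ∧ c ≤ τ e - τ i := by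
      intro T T' hs hT hx hsub
      obtain ⟨a, ha, s', hs', h⟩ := hT.prop s hs
      obtain ⟨e, he, hce⟩ := exists_canAccept_of_mem_fst' hmono hk hinf (i := i) (t := t + 1)
        (by omega) (hsub hs') (by rw [hr hx]; exact hmono hit)
      exact ⟨e, .step ha h he, hce⟩
    generalize (k t).loc = q at hstep hs h3
    generalize (k (t + 1)).loc = q' at hstep hmov hshift
    cases hstep with
    | waitBuffered _ _ _ _ _ hT => exact hmov hs hT rfl subset_rfl
    | finishBuffered _ _ _ hT => exact hshift hs hT rfl subset_rfl
    | pullBuffer _ _ _ _ _ _ hT => exact hmov hs hT rfl Set.subset_union_left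
    | pullFinishBuffered _ _ _ _ hT => exact hshift hs hT rfl Set.subset_union_left
    | _ => exact absurd hs (Set.notMem_empty s)

theorem exists_canAccept_init (hmono : Monotone τ)
    (hk : ∀ t, ∃ b, (k t).Moves A en τ c x b t (k (t + 1)))
    (hinf : ∀ N, ∃ i ≥ N, (k i).loc.1 = 0 ∨ (k i).loc.1 = 2)
    (ht : (k t).Moves A en τ c x true t (k (t + 1))) :
    ∃ e, A.CanAccept en t A.init e ∧ c ≤ τ e - τ t := by
  obtain ⟨g, r, hstep, -, -, hr, -⟩ := ht
  have hfst : ∀ {S : Set A.Loc}, A.VeeStep (en t) {A.init} S → x ∈ r →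
      S ⊆ (k (t + 1)).loc.2.1 → ∃ e, A.CanAccept en t A.init e ∧ c ≤ τ e - τ t := by
    intro S hS hx hsub
    obtain ⟨a, ha, s, hs, h⟩ := hS.prop A.init rfl
    obtain ⟨e, he, hce⟩ := exists_canAccept_of_mem_fst' hmono hk hinf (i := t) (t := t + 1)
      (by omega) (hsub hs) (hr hx).ge
    exact ⟨e, .step ha h he, hce⟩
  have hsnd : ∀ {S : Set A.Loc}, A.VeeStep (en t) {A.init} S → (k (t + 1)).loc.1 = 3 →
      S ⊆ (k (t + 1)).loc.2.2 → ∃ e, A.CanAccept en t A.init e ∧ c ≤ τ e - τ t := by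
    intro S hS h3 hsub
    obtain ⟨a, ha, s, hs, h⟩ := hS.prop A.init rfl
    obtain ⟨N, hN, hN'⟩ := hinf (t + 1)
    obtain ⟨d, rfl⟩ := Nat.exists_eq_add_of_le hN
    obtain ⟨e, he, hce⟩ := exists_canAccept_of_mem_snd hmono hk hinf (i := t) hN' d rfl
      (by omega) h3 (hsub hs)
    exact ⟨e, .step ha h he, hce⟩
  generalize (k t).loc = q at hstep
  generalize (k (t + 1)).loc = q' at hstep hfst hsnd
  cases hstep with
  | pullStart _ h0 => exact hfst h0 rfl subset_rfl
  | pullMerge _ _ _ _ _ _ h0 => exact hfst h0 rfl Set.subset_union_right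
  | pullOpenBuffer _ _ _ _ h0 => exact hsnd h0 rfl subset_rfl
  | pullBuffer _ _ _ _ _ _ _ h0 => exact hsnd h0 rfl Set.subset_union_right
  | pullFinish _ _ _ _ h0 => exact hfst h0 rfl subset_rfl
  | pullFinishBuffered _ _ _ _ _ h0 => exact hfst h0 rfl Set.subset_union_right

end Soundness

end ModalityNFA

/-! ### Runs of the automaton as families of tracks -/

theorem ClockConstraint.sat_conj {X : Type} {v : X → ℝ} : ∀ {m : ℕ} (g : Fin m → ClockConstraint X),
    (ClockConstraint.conj g).Sat v ↔ ∀ j, (g j).Sat v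
  | 0, g => by simp [conj, Sat]
  | m + 1, g => by
    have := sat_conj (v := v) fun j => g j.succ
    simp only [conj] at this
    simp [conj, Sat, List.ofFn_succ, Fin.forall_fin_succ, this]

/-- With finitely many locations, infinitely many visits to `F` include infinitely many to one of
its members. -/
theorem TimedAutomaton.isAccepting_iff {Γ : Type u} (C : TimedAutomaton Γ) (s : ℕ → C.Loc) :
    C.IsAccepting s ↔ ∀ F ∈ C.final, ∀ N, ∃ i ≥ N, s i ∈ F := by
  have := C.finiteLoc
  refine forall₂_congr fun F _ => ⟨fun ⟨q, hq, h⟩ N => ?_, fun h => ?_⟩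
  · obtain ⟨i, hi, rfl⟩ := h N
    exact ⟨i, hi, hq⟩
  · by_contra! hne
    have hev : ∀ q, ∀ᶠ i in Filter.atTop, ¬ (q ∈ F ∧ s i = q) := fun q => by
      by_cases hq : q ∈ F
      · obtain ⟨N, hN⟩ := hne q hq
        exact Filter.eventually_atTop.2 ⟨N, fun i hi h => hN i hi h.2⟩
      · exact .of_forall fun i h => hq h.1
    obtain ⟨N, hN⟩ := Filter.eventually_atTop.1 (Filter.eventually_all.2 hev)
    obtain ⟨i, hi, hF⟩ := h N
    exact hN i hi _ ⟨hF, rfl⟩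

open ModalityNFA in
-- Clock values and reset times determine each other: `ρ.time t - ρ.delay t` is the time of the
-- preceding event (or `0`), so a clock value is that time minus the stamp.
theorem mem_language_geComponent_iff {P : Type u} {n : ℕ} {A : ModalityNFA n} {c : ℕ} {p : P}
    {β : Fin n → BoolNNF P} {ρ : TimedWord (Set P)} :
    ρ ∈ (geComponent A c p β).language ↔
      ∃ K : ℕ → Fin (Nat.card A.Loc) → A.Track,
        (∀ j, (K 0 j).loc = (0, ∅, ∅) ∧ (K 0 j).stamp = 0) ∧
        (∀ t, ∃ pull : Fin (Nat.card A.Loc) → Bool,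
          (p ∈ ρ.letter t → ∃! j, pull j = true) ∧ (p ∉ ρ.letter t → ∀ j, pull j = false) ∧
            ∀ j, (K t j).Moves A (fun t => {a | (β a).Holds (ρ.letter t)}) ρ.time c j (pull j) t
              (K (t + 1) j)) ∧
        ∀ j N, ∃ i ≥ N, (K i j).loc.1 = 0 ∨ (K i j).loc.1 = 2 := by
  have hacc : ∀ s : ℕ → (geComponent A c p β).Loc, (geComponent A c p β).IsAccepting s ↔
      ∀ j N, ∃ i ≥ N, (s i j).1 = 0 ∨ (s i j).1 = 2 := fun s => by
    rw [TimedAutomaton.isAccepting_iff]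
    exact Set.forall_mem_range
  constructor
  · rintro ⟨s, v, ⟨h0, hv0, hrun⟩, ha⟩
    -- The representative and the deadline are dummies: `Moves` does not look at them.
    refine ⟨fun t j => ⟨s t j, ρ.time t - ρ.delay t - v t j, A.init, 0⟩,
      fun j => ⟨congrFun h0 j, by simp [TimedWord.delay, show v 0 j = 0 from hv0 j]⟩,
      fun t => ?_, (hacc s).1 ha⟩
    obtain ⟨g, r, ⟨pull, g', r', hp, hnp, hsub, rfl, rfl⟩, hg, hr⟩ := hrun t
    refine ⟨pull, hp, hnp, fun j => ⟨g' j, r' j, hsub j, (hsub j).reset_subset, fun u hu => ?_,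
      fun hj => ?_, fun hj => ?_⟩⟩
    · refine (hsub j).sat_congr ?_ (ClockConstraint.sat_conj g' |>.1 hg j)
      rw [hu]
      simp only
      ring
    · have := (hr j).trans (if_pos (Set.mem_iUnion.2 ⟨j, hj⟩))
      simp [this, TimedWord.delay]
    · have hnot : j ∉ ⋃ i, r' i := fun h => by
        obtain ⟨i, hi⟩ := Set.mem_iUnion.1 h
        obtain rfl : j = i := (hsub i).reset_subset hi
        exact hj hi
      have := (hr j).trans (if_neg hnot)
      simp only [this, TimedWord.delay]
      ring
  · rintro ⟨K, h0, hrun, ha⟩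
    refine ⟨fun t j => (K t j).loc, fun t j => ρ.time t - ρ.delay t - (K t j).stamp,
      ⟨funext fun j => (h0 j).1, fun j => by simp [TimedWord.delay, (h0 j).2], fun t => ?_⟩,
      (hacc _).2 ha⟩
    obtain ⟨pull, hp, hnp, hmov⟩ := hrun t
    choose g' r' hsub hrs hg hr hr' using hmov
    refine ⟨_, _, ⟨pull, g', r', hp, hnp, hsub, rfl, rfl⟩,
      (ClockConstraint.sat_conj g').2 fun j => hg j _ (by ring), fun j => ?_⟩
    have hmem : j ∈ (⋃ i, r' i) ↔ j ∈ r' j := by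
      refine ⟨fun h => ?_, fun h => Set.mem_iUnion.2 ⟨j, h⟩⟩
      obtain ⟨i, hi⟩ := Set.mem_iUnion.1 h
      obtain rfl : j = i := hrs i hi
      exact hi
    split_ifs with hj
    · simp [hr j (hmem.1 hj), TimedWord.delay]
    · simp only [hr' j fun h => hj (hmem.2 h), TimedWord.delay]
      ring

/-! ### Semantics of the formula and conclusion -/

namespace EMITL

variable {P : Type u} {ρ : TimedWord (Set P)}

theorem sat_or {φ χ : EMITL P} {i : ℕ} : (or φ χ).Sat ρ i ↔ φ.Sat ρ i ∨ χ.Sat ρ i := by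
  simp only [or, Sat]
  tauto

theorem sat_imp {φ χ : EMITL P} {i : ℕ} : (imp φ χ).Sat ρ i ↔ (φ.Sat ρ i → χ.Sat ρ i) := by
  simp only [imp, sat_or, Sat]
  tauto

theorem sat_eventually {φ : EMITL P} {i : ℕ} :
    (eventually φ).Sat ρ i ↔ ∃ k, φ.Sat ρ (i + k) := by
  simp only [eventually, untl, Sat]
  constructor
  · rintro ⟨k, -, w, ⟨r, -, htr, hfin⟩, hw⟩
    refine ⟨k, ?_⟩
    have hlast : r (Fin.last k).succ = true := by rw [Fin.succ_last]; exact hfin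
    obtain ⟨-, ⟨-, h⟩ | ⟨h, -⟩⟩ := htr (Fin.last k)
    · exact absurd (h.symm.trans hlast) (by decide)
    · have := hw (Fin.last k)
      rw [h] at this
      exact this
  · rintro ⟨k, hk⟩
    refine ⟨k, by simpa [TimeBound.toSet] using ρ.mono (Nat.le_add_right i k),
      fun t => if t = Fin.last k then 1 else 0, ⟨fun t => decide (t = Fin.last (k + 1)), ?_, ?_, ?_⟩,
      fun t => ?_⟩
    · exact decide_eq_false (Fin.last_pos).ne
    · intro t
      refine ⟨decide_eq_false (Fin.castSucc_lt_last t).ne, ?_⟩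
      by_cases ht : t = Fin.last k
      · subst ht
        exact .inr ⟨if_pos rfl, by simp⟩
      · exact .inl ⟨if_neg ht, decide_eq_false fun h => ht (by rwa [← Fin.succ_last, Fin.succ_inj] at h)⟩
    · exact decide_eq_true rfl
    · by_cases ht : t = Fin.last k
      · subst ht
        simpa using hk
      · simp [ht, Sat]

theorem sat_globally {φ : EMITL P} : (globally φ).Sat ρ 0 ↔ ∀ i, φ.Sat ρ i := by
  simp [globally, Sat, sat_eventually]

end EMITL

theorem BoolNNF.sat_toEMITL {P : Type u} {ρ : TimedWord (Set P)} {i : ℕ} (β : BoolNNF P) :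
    β.toEMITL.Sat ρ i ↔ β.Holds (ρ.letter i) := by
  induction β with
  | top => simp [toEMITL, EMITL.Sat, Holds]
  | bot => simp [toEMITL, EMITL.bot, EMITL.Sat, Holds]
  | atom p => rfl
  | negAtom p => rfl
  | and β γ ih₁ ih₂ => simp [toEMITL, EMITL.Sat, Holds, ih₁, ih₂]
  | or β γ ih₁ ih₂ => simp [toEMITL, EMITL.sat_or, Holds, ih₁, ih₂]

theorem EMITL.sat_aut_ge_iff {P : Type u} {n : ℕ} {A : ModalityNFA n} {c : ℕ}
    {β : Fin n → BoolNNF P} {ρ : TimedWord (Set P)} {i : ℕ} :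
    (EMITL.aut A (.ge c) fun a => (β a).toEMITL).Sat ρ i ↔
      ∃ e, A.CanAccept (fun t => {a | (β a).Holds (ρ.letter t)}) i A.init e ∧
        c ≤ ρ.time e - ρ.time i := by
  simp only [Sat, BoolNNF.sat_toEMITL, TimeBound.toSet, Set.mem_Ici]
  constructor
  · rintro ⟨k, hk, h⟩
    exact ⟨i + k, ModalityNFA.canAccept_init_iff.2 h, hk⟩
  · rintro ⟨e, h, he⟩
    obtain ⟨k, rfl⟩ := Nat.exists_eq_add_of_le h.le
    exact ⟨k, he, ModalityNFA.canAccept_init_iff.1 h⟩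

theorem language_geComponent {P : Type u} {n : ℕ} (A : ModalityNFA n) (c : ℕ) (p : P)
    (β : Fin n → BoolNNF P)
    (hc : 0 < c ∨ ∀ (k : ℕ) (w : Fin k → Fin n), 0 < k → A.Accepts w → 2 ≤ k) :
    (geComponent A c p β).language =
      (EMITL.globally (EMITL.imp (EMITL.atom p)
        (EMITL.aut A (.ge c) fun a => (β a).toEMITL))).language := by
  ext ρ
  rw [mem_language_geComponent_iff, EMITL.language, Set.mem_ofPred_eq, EMITL.sat_globally]
  simp only [EMITL.sat_imp, EMITL.sat_aut_ge_iff]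
  constructor
  · rintro ⟨K, -, hrun, hacc⟩ i hi
    obtain ⟨pull, hp, -, hmov⟩ := hrun i
    obtain ⟨j, hj, -⟩ := hp hi
    refine ModalityNFA.exists_canAccept_init (k := fun t => K t j) (x := j) ρ.mono (fun t => ?_)
      (hacc j) (hj ▸ hmov j)
    obtain ⟨pull, -, -, hmov⟩ := hrun t
    exact ⟨_, hmov j⟩
  · intro h
    refine ModalityNFA.exists_tracks ρ.nonZeno ρ.mono (fun t => p ∈ ρ.letter t) fun t ht => ?_
    obtain ⟨e, he, hce⟩ := h t ht
    -- Acceptance at the trigger position would mean elapsed time `0` and an accepted word of length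
    -- `1`; `hc` excludes one or the other.
    refine ⟨e, lt_of_le_of_ne he.le ?_, he, hce⟩
    rintro rfl
    rcases hc with hc | hc
    · have : (0 : ℝ) < c := by exact_mod_cast hc
      linarith
    · obtain ⟨w, hw, -⟩ := (ModalityNFA.canAccept_init_iff (k := 0)).1 he
      exact absurd (hc 1 w one_pos hw) (by norm_num)

theorem mainTheorem8 {AP : Type u} [Finite AP] (φ : EMITLNNF AP) {n : ℕ} (A : ModalityNFA n)
    (c : ℕ) (args : Fin n → EMITLNNF AP)
    (hψ : EMITLNNF.aut A (TimeBound.ge c) args ∈ φ.temporalSubs)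
    (hc : 0 < c ∨ ∀ (k : ℕ) (w : Fin k → Fin n), 0 < k → A.Accepts w → 2 ≤ k) :
    (geComponent A c (Sum.inr ⟨EMITLNNF.aut A (TimeBound.ge c) args, hψ⟩ : φ.ExtProp)
        (fun a => EMITLNNF.overline φ (args a) (EMITLNNF.arg_temporalSubs_subset hψ a))).language =
      (EMITL.globally
        (EMITL.imp (EMITL.atom (Sum.inr ⟨EMITLNNF.aut A (TimeBound.ge c) args, hψ⟩ : φ.ExtProp))
          (EMITL.aut A (TimeBound.ge c) fun a =>
            (EMITLNNF.overline φ (args a) (EMITLNNF.arg_temporalSubs_subset hψ a)).toEMITL))).language :=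
  language_geComponent A c _ _ hc
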